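/- Let $K\ge 2$, let $(\mathcal H,d)$ be a separable metric space with its Borel $\sigma$-algebra, and let $(X_1,Y_1),(X_2,Y_2),\dots$ be i.i.d. copies of a pair $(X,Y)$, where $X$ takes values in $\mathcal H$ and $Y$ in $\{1,\dots,K\}$. For $n\ge 2$ and $1\le i\le n$ let $N(i)=N_n(i)\in\{1,\dots,n\}\setminus\{i\}$ be the index $j$ that minimises $d(X_i,X_j)$; assume that almost surely, for all $n\ge2$ and $i\le n$, this nearest neighbour is unique. For each $k\in\{1,\dots,K\}$ let $x\mapsto Q_k(x)$ be a measurable version of $x\mapsto P(Y=k\mid X=x)$, and put $$f(x,u)=\min\Big\{k\in\{1,\dots,K\}:\ \sum_{j=1}^k Q_j(x)>u\Big\},\qquad u\in(0,1),$$ with $f(x,u)=0$ if this set is empty (which happens only for $x$ in a $P_X$-null set). Let $U,U'$ be uniformly distributed on $(0,1)$ with $X,U,U'$ independent, and write $p_{i,j}=P(f(X,U)=i,\ f(X,U')=j)$, $p_i=P(f(X,U)=i)=P(Y=i)$ and $q_j=P(f(X,U')=j)$. Define $$\psi(X,Y)=\frac1{K-1}\sum_{i,j=1}^K\frac{(p_{i,j}-p_iq_j)^2}{p_iq_j},\qquad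 \widehat\psi_n(X,Y)=\frac1{K-1}\sum_{k,l=1}^K\frac{(\widehat p_{k,l}-\widehat p_k\widehat q_l)^2}{\widehat p_k\widehat q_l},$$ where $$\widehat p_{k,l}=\frac1n\sum_{i=1}^n 1\{Y_i=k,\ Y_{N(i)}=l\},\qquad \widehat p_k=\sum_{l=1}^K\widehat p_{k,l},\qquad \widehat q_l=\sum_{k=1}^K\widehat p_{k,l},$$ and summands with denominator $0$ are read as $0$. Theorem. Assume that at least one of the following conditions holds: (a) for Lebesgue-almost every $u\in(0,1)$, $f(X_{N_n(1)},u)\to f(X_1,u)$ in probability as $n\to\infty$; (b) for every $k\in\{1,\dots,K\}$, the function $Q_k$ is continuous at $P_X$-almost every point of $\mathcal H$. Then $\widehat\psi_n(X,Y)\to\psi(X,Y)$ in probability as $n\to\infty$. -/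

import Mathlib

open MeasureTheory ProbabilityTheory Filter Topology

noncomputable section

namespace CategoricalDependence

/-- `Q k` is, for every level `k` in `{1, …, K}`, a version of the conditional probability
`x ↦ P(Y = k | X = x)`. -/
def IsCondProb {Ω H : Type*} [MeasurableSpace Ω] [mH : MeasurableSpace H] (μ : Measure Ω)
    (X : Ω → H) (Y : Ω → ℕ) (K : ℕ) (Q : ℕ → H → ℝ) : Prop :=
  ∀ k ∈ Finset.Icc 1 K, Measurable (Q k) ∧
    (fun ω => Q k (X ω)) =ᵐ[μ] μ[(Y ⁻¹' {k}).indicator (fun _ => (1 : ℝ)) | mH.comap X]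

/-- `f(x, u) = min {k ∈ {1, …, K} : Q₁(x) + … + Q_k(x) > u}`. -/
def quantileMap {H : Type*} (K : ℕ) (Q : ℕ → H → ℝ) (x : H) (u : ℝ) : ℕ :=
  sInf {k : ℕ | k ∈ Finset.Icc 1 K ∧ u < ∑ j ∈ Finset.Icc 1 k, Q j x}

/-- The uniform distribution on `(0, 1)`. -/
def uniform01 : Measure ℝ := volume.restrict (Set.Ioo 0 1)

/-- Cramér's V of a `K × K` table `p` of probabilities with row and column marginals `r`, `c`. -/
def cramerV (K : ℕ) (p : ℕ → ℕ → ℝ) (r c : ℕ → ℝ) : ℝ :=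
  1 / ((K : ℝ) - 1) * ∑ k ∈ Finset.Icc 1 K, ∑ l ∈ Finset.Icc 1 K,
    (p k l - r k * c l) ^ 2 / (r k * c l)

/-- The law of `(X, U, U')`, where `X` has law `PX`, where `U` and `U'` are uniform on `(0, 1)`,
and the three variables are independent. -/
def couplingLaw {H : Type*} [MeasurableSpace H] (PX : Measure H) : Measure (H × ℝ × ℝ) :=
  PX.prod (uniform01.prod uniform01)

/-- The population coefficient `ψ(X, Y) = V(Y, Y')` with `Y = f(X, U)` and `Y' = f(X, U')`. -/
def psi {H : Type*} [MeasurableSpace H] (K : ℕ) (Q : ℕ → H → ℝ) (PX : Measure H) : ℝ :=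
  cramerV K
    (fun i j => (couplingLaw PX).real
      {z | quantileMap K Q z.1 z.2.1 = i ∧ quantileMap K Q z.1 z.2.2 = j})
    (fun i => (couplingLaw PX).real {z | quantileMap K Q z.1 z.2.1 = i})
    (fun j => (couplingLaw PX).real {z | quantileMap K Q z.1 z.2.2 = j})

/-- Among the first `n` points `x 0, …, x (n - 1)` (the sample is indexed from `0`), the point
`x j` is a nearest neighbour of `x i`. -/
def IsNearestNeighbor {H : Type*} [Dist H] (x : ℕ → H) (n i j : ℕ) : Prop :=
  j < n ∧ j ≠ i ∧ ∀ m < n, m ≠ i → dist (x i) (x j) ≤ dist (x i) (x m)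

/-- The index `N(i)` of the nearest neighbour of `x i` among the first `n` points. -/
def nnIndex {H : Type*} [Dist H] (x : ℕ → H) (n i : ℕ) : ℕ :=
  sInf {j | IsNearestNeighbor x n i j}

/-- `(1 / n) ∑ᵢ 1{yᵢ = k, y_{N(i)} = l}`. -/
def pHat {H : Type*} [Dist H] (x : ℕ → H) (y : ℕ → ℕ) (n k l : ℕ) : ℝ :=
  1 / (n : ℝ) * ∑ i ∈ Finset.range n, if y i = k ∧ y (nnIndex x n i) = l then 1 else 0

/-- The nearest-neighbour plug-in estimator computed from `(x i, y i)`, `i < n`. -/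
def psiHat {H : Type*} [Dist H] (K : ℕ) (x : ℕ → H) (y : ℕ → ℕ) (n : ℕ) : ℝ :=
  cramerV K (pHat x y n)
    (fun k => ∑ l ∈ Finset.Icc 1 K, pHat x y n k l)
    (fun l => ∑ k ∈ Finset.Icc 1 K, pHat x y n k l)

/-- Almost surely, in every sample of size `n ≥ 2` every point has exactly one nearest neighbour. -/
def UniqueNearestNeighbors {Ω H : Type*} [MeasurableSpace Ω] [Dist H] (μ : Measure Ω)
    (X : ℕ → Ω → H) : Prop :=
  ∀ᵐ ω ∂μ, ∀ n ≥ 2, ∀ i < n, ∃! j, IsNearestNeighbor (fun m => X m ω) n i j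

/-- For almost all `u ∈ (0, 1)`, `f(X_{N(1)}, u) → f(X₁, u)` in probability. -/
def NeighborConvergence {Ω H : Type*} [MeasurableSpace Ω] [Dist H] (μ : Measure Ω)
    (X : ℕ → Ω → H) (K : ℕ) (Q : ℕ → H → ℝ) : Prop :=
  ∀ᵐ u ∂uniform01, TendstoInMeasure μ
    (fun n ω => quantileMap K Q (X (nnIndex (fun m => X m ω) n 0) ω) u) atTop
    (fun ω => quantileMap K Q (X 0 ω) u)

/-- For each level `k`, the map `Q k` is continuous at `PX`-almost every point. -/
def AECondProbContinuous {H : Type*} [TopologicalSpace H] [MeasurableSpace H] (PX : Measure H)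
    (K : ℕ) (Q : ℕ → H → ℝ) : Prop :=
  ∀ k ∈ Finset.Icc 1 K, ∀ᵐ x ∂PX, ContinuousAt (Q k) x

end CategoricalDependence

end

/-! Given `X`, the variables `f(X, U)` and `f(X, U')` are independent with conditional probabilities
`Q_k(X)`, so `p_{k,l} = E[Q_k(X) Q_l(X)]` and the marginals are `E[Q_k(X)]`. Everything reduces to
showing that `pHat` converges in probability to `E[Q_k(X) Q_l(X)]`.

Write each indicator as a regression function plus a residual. With `g = Q_k`, `h = Q_l` and `N =
N(i)`, `1{Y_i = k} 1{Y_N = l} = r_k(i) 1{Y_N = l} + g(X_i) r_l(N) + g(X_i) (h(X_N) - h(X_i)) +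
g(X_i) h(X_i)`. The last average obeys the law of large numbers. The third is controlled in `L¹` by
exchangeability and either (a) or (b). The first two vanish in `L²`: a residual is orthogonal to
every bounded weight that ignores its own label (`integral_mul_residual_eq_zero`), so few cross
terms survive.

For the first average, a cross term needs `i = j`, `N(i) = j` or `N(j) = i`, which gives a second
moment of at most `3n` before normalisation. For the second it needs `N(i) = N(j)`. A general metric
space gives no bound on how many points share a neighbour; instead, uniqueness of neighbours
excludes atoms, so two independent points are rarely close, while neighbour distances tend to `0`.
Hence these coincidences number `o(n²)` in expectation (`tendsto_sum_measureReal_nnIndex_eq`).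

Convergence in probability is expressed as `Tendsto` along the filter `inMeasure`, so that the
algebra of limits applies directly to Cramér's V. -/

namespace CategoricalDependence

/-! ### Measurability of minimal indices and of the quantile map -/

section Measurability

theorem measurable_sInf_nat {α : Type*} [MeasurableSpace α] {P : α → ℕ → Prop}
    (hP : ∀ j, MeasurableSet {a | P a j}) : Measurable fun a => sInf {j | P a j} := by
  have key : ∀ k, MeasurableSet {a | P a k ∧ ∀ j < k, ¬ P a j} := fun k => by
    have : {a | P a k ∧ ∀ j < k, ¬ P a j} = {a | P a k} ∩ ⋂ j, ⋂ (_ : j < k), {a | P a j}ᶜ := by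
      ext a; simp
    rw [this]
    exact (hP k).inter (MeasurableSet.iInter fun j => MeasurableSet.iInter fun _ => (hP j).compl)
  have hnone : MeasurableSet {a | ∀ j, ¬ P a j} := by
    have : {a | ∀ j, ¬ P a j} = ⋂ j, {a | P a j}ᶜ := by ext a; simp
    rw [this]
    exact MeasurableSet.iInter fun j => (hP j).compl
  have hval : ∀ a k, P a k → (∀ j < k, ¬ P a j) → sInf {j | P a j} = k := fun a k h1 h2 =>
    le_antisymm (Nat.sInf_le h1) (not_lt.1 fun h => h2 _ h (Nat.sInf_mem (s := {j | P a j}) ⟨k, h1⟩))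
  refine measurable_to_countable' fun k => ?_
  -- Since `sInf ∅ = 0`, the fibre over `0` also contains the points where no index qualifies.
  have : (fun a => sInf {j | P a j}) ⁻¹' {k} =
      {a | P a k ∧ ∀ j < k, ¬ P a j} ∪ ({a | ∀ j, ¬ P a j} ∩ {_a | k = 0}) := by
    ext a
    simp only [Set.mem_preimage, Set.mem_singleton_iff, Set.mem_union, Set.mem_ofPred_eq,
      Set.mem_inter_iff]
    constructor
    · rintro rfl
      by_cases h : ∃ j, P a j
      · exact Or.inl ⟨Nat.sInf_mem (s := {j | P a j}) h,
          fun j hj => Nat.notMem_of_lt_sInf (s := {j | P a j}) hj⟩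
      · push Not at h
        exact Or.inr ⟨h, by simp [h]⟩
    · rintro (⟨h1, h2⟩ | ⟨h, rfl⟩)
      · exact hval a k h1 h2
      · simp [h]
  rw [this]
  exact (key k).union (hnone.inter (MeasurableSet.const _))

variable {α H : Type*} [MeasurableSpace α] [MeasurableSpace H]

theorem measurable_apply_nat {β : Type*} [MeasurableSpace β] {X : ℕ → α → β}
    (hX : ∀ i, Measurable (X i)) {N : α → ℕ} (hN : Measurable N) :
    Measurable fun a => X (N a) a :=
  (measurable_from_prod_countable_right (f := fun p : ℕ × α => X p.1 p.2) hX).comp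
    (hN.prodMk measurable_id)

theorem measurable_quantileMap {K : ℕ} {Q : ℕ → H → ℝ}
    (hQ : ∀ k ∈ Finset.Icc 1 K, Measurable (Q k)) :
    Measurable fun z : H × ℝ => quantileMap K Q z.1 z.2 := by
  refine measurable_sInf_nat fun k => ?_
  by_cases hk : k ∈ Finset.Icc 1 K
  · simp only [hk, true_and]
    refine measurableSet_lt measurable_snd (Finset.measurable_sum _ fun j hj => ?_)
    refine (hQ j ?_).comp measurable_fst
    simp only [Finset.mem_Icc] at hk hj ⊢
    omega
  · simp [hk]

end Measurability

/-! ### Nearest neighbours of finite samples -/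

section NearestNeighbor

variable {H : Type*} [MetricSpace H]

theorem exists_isNearestNeighbor (x : ℕ → H) {n : ℕ} (hn : 2 ≤ n) (i : ℕ) :
    ∃ j, IsNearestNeighbor x n i j := by
  have hne : ((Finset.range n).erase i).Nonempty := by
    by_cases hi : i = 0
    · exact ⟨1, by simp; omega⟩
    · exact ⟨0, by simp; omega⟩
  obtain ⟨j, hj, hmin⟩ := Finset.exists_min_image _ (fun m => dist (x i) (x m)) hne
  simp only [Finset.mem_erase, Finset.mem_range] at hj hmin
  exact ⟨j, hj.2, hj.1, fun m hm hmi => hmin m ⟨hmi, hm⟩⟩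

theorem isNearestNeighbor_nnIndex (x : ℕ → H) {n : ℕ} (hn : 2 ≤ n) (i : ℕ) :
    IsNearestNeighbor x n i (nnIndex x n i) :=
  Nat.sInf_mem (exists_isNearestNeighbor x hn i)

/-- Being a nearest neighbour is invariant under relabelling, but breaking ties by the smallest
index is not; uniqueness removes the ties. -/
theorem nnIndex_perm {x : ℕ → H} {n : ℕ} (hn : 2 ≤ n) {σ : Equiv.Perm ℕ}
    (hσ : ∀ m, σ m < n ↔ m < n) {i : ℕ} (hu : ∃! j, IsNearestNeighbor x n (σ i) j) :
    σ (nnIndex (fun m => x (σ m)) n i) = nnIndex x n (σ i) := by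
  refine hu.unique ?_ (isNearestNeighbor_nnIndex x hn _)
  obtain ⟨h1, h2, h3⟩ := isNearestNeighbor_nnIndex (fun m => x (σ m)) hn i
  refine ⟨(hσ _).2 h1, fun h => h2 (σ.injective h), fun m hm hmi => ?_⟩
  have := h3 (σ.symm m) ((hσ _).1 (by simpa using hm)) (fun h => hmi (by simp [← h]))
  simpa using this

variable [TopologicalSpace.SeparableSpace H] [MeasurableSpace H] [BorelSpace H]

theorem measurable_nnIndex {α : Type*} [MeasurableSpace α] {X : ℕ → α → H}
    (hX : ∀ i, Measurable (X i)) (n i : ℕ) : Measurable fun a => nnIndex (fun m => X m a) n i := by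
  have : SecondCountableTopology H := UniformSpace.secondCountable_of_separable H
  refine measurable_sInf_nat fun j => ?_
  have : {a | IsNearestNeighbor (fun m => X m a) n i j} = {_a | j < n} ∩ ({_a | j ≠ i} ∩
      ⋂ m, ⋂ (_ : m < n), ⋂ (_ : m ≠ i), {a | dist (X i a) (X j a) ≤ dist (X i a) (X m a)}) := by
    ext a; simp [IsNearestNeighbor]
  rw [this]
  refine (MeasurableSet.const _).inter ((MeasurableSet.const _).inter ?_)
  exact MeasurableSet.iInter fun m => MeasurableSet.iInter fun _ => MeasurableSet.iInter fun _ =>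
    measurableSet_le ((hX i).dist (hX j)) ((hX i).dist (hX m))

end NearestNeighbor

/-! ### Convergence in probability as convergence along a filter -/

section InMeasure

variable {Ω : Type*} [MeasurableSpace Ω]

/-- The filter on `ℕ × Ω` of the sets whose sections have complements of vanishing measure, so
that `Tendsto` along it is convergence in measure. -/
def inMeasure (μ : Measure Ω) : Filter (ℕ × Ω) where
  sets := {s | Tendsto (fun n => μ {ω | (n, ω) ∉ s}) atTop (𝓝 0)}
  univ_sets := by simp
  sets_of_superset := fun {s t} hs hst => tendsto_of_tendsto_of_tendsto_of_le_of_le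
    tendsto_const_nhds hs (fun _ => zero_le)
    (fun n => measure_mono fun ω hω h => hω (hst h))
  inter_sets := fun {s t} hs ht => by
    have h := Tendsto.add hs ht
    rw [add_zero] at h
    refine tendsto_of_tendsto_of_tendsto_of_le_of_le tendsto_const_nhds h (fun _ => zero_le)
      (fun n => (measure_mono fun ω hω => ?_).trans (measure_union_le _ _))
    by_contra hc
    simp only [Set.mem_union, Set.mem_ofPred_eq, not_or, not_not] at hc
    exact hω hc

theorem eventually_inMeasure {μ : Measure Ω} {p : ℕ × Ω → Prop} :
    (∀ᶠ z in inMeasure μ, p z) ↔ Tendsto (fun n => μ {ω | ¬ p (n, ω)}) atTop (𝓝 0) :=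
  Iff.rfl

theorem eventually_inMeasure_of_ae {μ : Measure Ω} {p : ℕ × Ω → Prop}
    (h : ∀ᶠ n in atTop, ∀ᵐ ω ∂μ, p (n, ω)) : ∀ᶠ z in inMeasure μ, p z := by
  rw [eventually_inMeasure]
  refine tendsto_const_nhds.congr' ?_
  filter_upwards [h] with n hn using (ae_iff.1 hn).symm

theorem tendstoInMeasure_const_iff {μ : Measure Ω} {f : ℕ → Ω → ℝ} {c : ℝ} :
    TendstoInMeasure μ f atTop (fun _ => c) ↔
      Tendsto (fun z : ℕ × Ω => f z.1 z.2) (inMeasure μ) (𝓝 c) := by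
  rw [tendstoInMeasure_iff_dist, Metric.tendsto_nhds]
  simp [eventually_inMeasure]

theorem tendsto_inMeasure_of_tendsto_integral {μ : Measure Ω} [IsFiniteMeasure μ]
    {f : ℕ → Ω → ℝ} (hf : ∀ n, Integrable (f n) μ) (h0 : ∀ n ω, 0 ≤ f n ω)
    (h : Tendsto (fun n => ∫ ω, f n ω ∂μ) atTop (𝓝 0)) :
    Tendsto (fun z : ℕ × Ω => f z.1 z.2) (inMeasure μ) (𝓝 0) := by
  rw [← tendstoInMeasure_const_iff, tendstoInMeasure_iff_measureReal_dist]
  intro ε hε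
  have h' := h.const_mul ε⁻¹
  rw [mul_zero] at h'
  refine tendsto_of_tendsto_of_tendsto_of_le_of_le tendsto_const_nhds h'
    (fun _ => measureReal_nonneg) (fun n => ?_)
  have := mul_meas_ge_le_integral_of_nonneg (Eventually.of_forall (h0 n)) (hf n) ε
  rw [le_inv_mul_iff₀ hε]
  simpa [abs_of_nonneg (h0 n _)] using this

theorem tendsto_inMeasure_of_tendsto_integral_sq {μ : Measure Ω} [IsFiniteMeasure μ]
    {f : ℕ → Ω → ℝ} (hf : ∀ n, Integrable (fun ω => f n ω ^ 2) μ)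
    (h : Tendsto (fun n => ∫ ω, f n ω ^ 2 ∂μ) atTop (𝓝 0)) :
    Tendsto (fun z : ℕ × Ω => f z.1 z.2) (inMeasure μ) (𝓝 0) := by
  have h1 := (tendsto_inMeasure_of_tendsto_integral hf (fun _ _ => sq_nonneg _) h).sqrt
  simp only [Real.sqrt_sq_eq_abs, Real.sqrt_zero] at h1
  exact (tendsto_zero_iff_abs_tendsto_zero _).2 h1

end InMeasure

/-! ### Orthogonality of regression residuals in an i.i.d. sample -/

section Sample

variable {Ω H : Type*} [MeasurableSpace Ω] [MeasurableSpace H]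

/-- The pairs `(X i, Y i)` are independent and identically distributed. -/
structure IsIIDSample (μ : Measure Ω) (X : ℕ → Ω → H) (Y : ℕ → Ω → ℕ) : Prop where
  measurable_left : ∀ i, Measurable (X i)
  measurable_right : ∀ i, Measurable (Y i)
  indep : iIndepFun (fun i ω => (X i ω, Y i ω)) μ
  ident : ∀ i, IdentDistrib (fun ω => (X i ω, Y i ω)) (fun ω => (X 0 ω, Y 0 ω)) μ μ

/-- `g` is a `[0, 1]`-valued version of `x ↦ P(Y = k | X = x)`. -/
structure IsRegression (μ : Measure Ω) (X : Ω → H) (Y : Ω → ℕ) (k : ℕ) (g : H → ℝ) : Prop where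
  measurable : Measurable g
  nonneg : ∀ x, 0 ≤ g x
  le_one : ∀ x, g x ≤ 1
  orthogonal : ∀ φ : H → ℝ, Measurable φ → (∃ C, ∀ x, |φ x| ≤ C) →
    ∫ ω, φ (X ω) * ((if Y ω = k then 1 else 0) - g (X ω)) ∂μ = 0

/-- The regression residual `1{y = k} - g(x)`. -/
def residual (k : ℕ) (g : H → ℝ) (z : H × ℕ) : ℝ := (if z.2 = k then 1 else 0) - g z.1

theorem measurable_ite_eq {α : Type*} [MeasurableSpace α] {f g : α → ℕ} (hf : Measurable f)
    (hg : Measurable g) : Measurable fun a => if f a = g a then (1 : ℝ) else 0 :=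
  Measurable.ite (measurableSet_eq_fun hf hg) measurable_const measurable_const

theorem measurable_residual {k : ℕ} {g : H → ℝ} (hg : Measurable g) :
    Measurable (residual k g) :=
  (measurable_ite_eq measurable_snd measurable_const).sub (hg.comp measurable_fst)

theorem IsRegression.abs_residual_le {μ : Measure Ω} {X : Ω → H} {Y : Ω → ℕ} {k : ℕ} {g : H → ℝ}
    (hg : IsRegression μ X Y k g) (z : H × ℕ) : |residual k g z| ≤ 1 := by
  have h0 := hg.nonneg z.1
  have h1 := hg.le_one z.1
  rw [residual, abs_le]
  split_ifs <;> constructor <;> linarith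

theorem integrable_of_abs_le {μ : Measure Ω} [IsFiniteMeasure μ] {f : Ω → ℝ} (hf : Measurable f)
    {C : ℝ} (hC : ∀ ω, |f ω| ≤ C) : Integrable f μ :=
  Integrable.of_bound hf.aestronglyMeasurable C (Eventually.of_forall hC)

variable {μ : Measure Ω} [IsProbabilityMeasure μ] {X : ℕ → Ω → H} {Y : ℕ → Ω → ℕ}

omit [IsProbabilityMeasure μ] in
theorem indepFun_rest {β : Type*} [MeasurableSpace β] {Z : ℕ → Ω → β}
    (hZ : ∀ i, Measurable (Z i)) (h : iIndepFun Z μ) (i : ℕ) :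
    IndepFun (Z i) (fun ω (m : {m // m ≠ i}) => Z m ω) μ := by
  rw [IndepFun_iff_Indep]
  have := indep_iSup_of_disjoint (fun j => (hZ j).comap_le) h.iIndep
    (S := {i}) (T := {i}ᶜ) disjoint_compl_right
  refine indep_of_indep_of_le_left (indep_of_indep_of_le_right this ?_) ?_
  · rw [MeasurableSpace.pi, MeasurableSpace.comap_iSup]
    refine iSup_le fun m => ?_
    rw [MeasurableSpace.comap_comp]
    exact le_iSup₂_of_le (m : ℕ) m.2 le_rfl
  · simp

/-- The pair at `i` is independent of all the others. With the others frozen, the weight is a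
bounded function of `X i` alone, and the defining property of a regression function makes the inner
integral vanish. -/
theorem integral_mul_residual_eq_zero (hS : IsIIDSample μ X Y) {k : ℕ} {g : H → ℝ}
    (hg : IsRegression μ (X 0) (Y 0) k g) (i : ℕ) {w : (ℕ → H) × (ℕ → ℕ) → ℝ}
    (hw : Measurable w) {C : ℝ} (hC : ∀ z, |w z| ≤ C)
    (hwi : ∀ x y c, w (x, Function.update y i c) = w (x, y)) :
    ∫ ω, w (fun m => X m ω, fun m => Y m ω) * residual k g (X i ω, Y i ω) ∂μ = 0 := by
  have hZ : ∀ i, Measurable fun ω => (X i ω, Y i ω) := fun i =>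
    (hS.measurable_left i).prodMk (hS.measurable_right i)
  have hV : Measurable fun ω (m : {m // m ≠ i}) => (X m ω, Y m ω) :=
    measurable_pi_lambda _ fun m => hZ m
  -- Rebuilds the sample from `X i` and the other pairs, with the dummy label `0` at `i`; by `hwi`
  -- the weight does not notice.
  let join : H × ({m // m ≠ i} → H × ℕ) → (ℕ → H) × (ℕ → ℕ) := fun p =>
    (fun m => if h : m = i then p.1 else (p.2 ⟨m, h⟩).1,
      fun m => if h : m = i then 0 else (p.2 ⟨m, h⟩).2)
  have hjoin : Measurable join := by
    refine Measurable.prodMk (measurable_pi_lambda _ fun m => ?_)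
      (measurable_pi_lambda _ fun m => ?_)
    · by_cases h : m = i
      · simpa [h] using measurable_fst
      · simp only [h, dite_false]; fun_prop
    · by_cases h : m = i
      · simp [h]
      · simp only [h, dite_false]; fun_prop
  let F : (H × ℕ) × ({m // m ≠ i} → H × ℕ) → ℝ := fun p =>
    w (join (p.1.1, p.2)) * residual k g p.1
  have hF : Measurable F := (hw.comp (hjoin.comp (by fun_prop))).mul
    ((measurable_residual hg.measurable).comp measurable_fst)
  have hFC : ∀ p, |F p| ≤ C := fun p => by
    rw [abs_mul]
    exact (mul_le_of_le_one_right (abs_nonneg _) (hg.abs_residual_le _)).trans (hC _)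
  have hrw : ∀ ω, w (fun m => X m ω, fun m => Y m ω) * residual k g (X i ω, Y i ω) =
      F ((X i ω, Y i ω), fun m => (X m ω, Y m ω)) := fun ω => by
    simp only [F]
    congr 1
    rw [← hwi _ _ 0]
    congr 2
    · funext m
      by_cases h : m = i
      · simp [h]
      · simp [h]
    · funext m
      by_cases h : m = i
      · simp [h]
      · simp [h]
  simp_rw [hrw]
  have hind := indepFun_rest hZ hS.indep i
  rw [indepFun_iff_map_prod_eq_prod_map_map (hZ i).aemeasurable hV.aemeasurable] at hind
  have hPZ := Measure.isProbabilityMeasure_map (μ := μ) (hZ i).aemeasurable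
  have hPV := Measure.isProbabilityMeasure_map (μ := μ) hV.aemeasurable
  rw [← integral_map (φ := fun ω => ((X i ω, Y i ω), fun m : {m // m ≠ i} => (X m ω, Y m ω)))
    ((hZ i).prodMk hV).aemeasurable hF.aestronglyMeasurable, hind,
    integral_prod_symm _ (integrable_of_abs_le hF hFC)]
  refine integral_eq_zero_of_ae (Eventually.of_forall fun v => ?_)
  have hm : Measurable fun z : H × ℕ => F (z, v) := hF.comp (by fun_prop)
  simp only [Pi.zero_apply]
  rw [(hS.ident i).map_eq, integral_map (hZ 0).aemeasurable hm.aestronglyMeasurable]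
  exact hg.orthogonal (fun x => w (join (x, v))) (hw.comp (hjoin.comp (by fun_prop)))
    ⟨C, fun x => hC _⟩

end Sample

/-! ### Second moment bounds for sums of residuals -/

section SecondMoment

variable {Ω : Type*} [MeasurableSpace Ω] {μ : Measure Ω} [IsProbabilityMeasure μ]

/-- Expanding the square, the `(i, j)` term integrates to zero off `B i j` and is at most `1` on it.
-/
theorem integral_sum_sq_le {F : ℕ → Ω → ℝ} (hF : ∀ i, Measurable (F i))
    (hF1 : ∀ i ω, |F i ω| ≤ 1) {B : ℕ → ℕ → Set Ω} (hB : ∀ i j, MeasurableSet (B i j)) {n : ℕ}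
    (h0 : ∀ i < n, ∀ j < n, ∫ ω, (B i j)ᶜ.indicator (fun ω => F i ω * F j ω) ω ∂μ = 0) :
    ∫ ω, (∑ i ∈ Finset.range n, F i ω) ^ 2 ∂μ ≤
      ∑ i ∈ Finset.range n, ∑ j ∈ Finset.range n, μ.real (B i j) := by
  have hmul : ∀ i j ω, |F i ω * F j ω| ≤ 1 := fun i j ω => by
    rw [abs_mul]; exact mul_le_one₀ (hF1 i ω) (abs_nonneg _) (hF1 j ω)
  have hint : ∀ i j, Integrable (fun ω => F i ω * F j ω) μ := fun i j =>
    integrable_of_abs_le ((hF i).mul (hF j)) (hmul i j)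
  simp_rw [pow_two, Finset.sum_mul_sum]
  rw [integral_finsetSum _ fun i _ => integrable_finsetSum _ fun j _ => hint i j]
  refine Finset.sum_le_sum fun i hi => ?_
  rw [integral_finsetSum _ fun j _ => hint i j]
  refine Finset.sum_le_sum fun j hj => ?_
  have h := h0 i (Finset.mem_range.1 hi) j (Finset.mem_range.1 hj)
  rw [integral_indicator (hB i j).compl] at h
  rw [← integral_add_compl (hB i j) (hint i j), h, add_zero]
  calc ∫ ω in B i j, F i ω * F j ω ∂μ ≤ ∫ ω in B i j, (1 : ℝ) ∂μ :=
        integral_mono (hint i j).integrableOn (integrable_const _)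
          fun ω => (le_abs_self _).trans (hmul i j ω)
    _ = μ.real (B i j) := by simp

theorem sum_measureReal_eq_le_one {N : Ω → ℕ} (hN : Measurable N) (s : Finset ℕ) :
    ∑ j ∈ s, μ.real {ω | N ω = j} ≤ 1 := by
  have : ∑ j ∈ s, μ.real (N ⁻¹' {j}) ≤ 1 := by
    rw [← measureReal_biUnion_finset]
    · exact measureReal_le_one
    · exact fun a _ b _ hab => Disjoint.preimage _ (by simpa using hab)
    · exact fun j _ => hN (measurableSet_singleton j)
  exact this

variable {H : Type*} [MetricSpace H] [TopologicalSpace.SeparableSpace H] [MeasurableSpace H]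
  [BorelSpace H] {X : ℕ → Ω → H} {Y : ℕ → Ω → ℕ}

/-- For `i ≠ j`, when neither point is the other's neighbour, the rest of the cross term ignores
label `i`. The constant `3` counts the diagonal and the events `N(i) = j` and `N(j) = i`, each
contributing at most `n`. -/
theorem integral_sum_residual_mul_sq_le (hS : IsIIDSample μ X Y) {k : ℕ} {g : H → ℝ}
    (hg : IsRegression μ (X 0) (Y 0) k g) (l : ℕ) {n : ℕ} (hn : 2 ≤ n) :
    ∫ ω, (∑ i ∈ Finset.range n, residual k g (X i ω, Y i ω) *
      if Y (nnIndex (fun m => X m ω) n i) ω = l then 1 else 0) ^ 2 ∂μ ≤ 3 * n := by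
  have hN : ∀ i, Measurable fun ω => nnIndex (fun m => X m ω) n i :=
    measurable_nnIndex hS.measurable_left n
  have hYN : ∀ i, Measurable fun ω => Y (nnIndex (fun m => X m ω) n i) ω := fun i =>
    measurable_apply_nat hS.measurable_right (hN i)
  have hres := measurable_residual (k := k) hg.measurable
  have hone : ∀ a b : ℕ, |(if a = b then (1 : ℝ) else 0)| ≤ 1 := fun a b => by
    split_ifs <;> simp
  have hset : ∀ i j, MeasurableSet {ω | nnIndex (fun m => X m ω) n i = j} := fun i j =>
    hN i (measurableSet_singleton j)
  let B : ℕ → ℕ → Set Ω := fun i j => {_ω | i = j} ∪ ({ω | nnIndex (fun m => X m ω) n i = j} ∪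
    {ω | nnIndex (fun m => X m ω) n j = i})
  refine (integral_sum_sq_le (B := B) ?_ ?_ ?_ ?_).trans ?_
  · exact fun i => (hres.comp ((hS.measurable_left i).prodMk (hS.measurable_right i))).mul
      (measurable_ite_eq (hYN i) measurable_const)
  · intro i ω
    rw [abs_mul]
    exact mul_le_one₀ (hg.abs_residual_le _) (abs_nonneg _) (hone _ _)
  · exact fun i j => (MeasurableSet.const _).union ((hset i j).union (hset j i))
  · intro i _ j _
    by_cases hij : i = j
    · have : B i j = Set.univ := by simp [B, hij]
      simp [this]
    let nn : ℕ → (ℕ → H) × (ℕ → ℕ) → ℕ := fun a z => nnIndex z.1 n a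
    have hnn : ∀ a, Measurable (nn a) := fun a =>
      measurable_nnIndex (X := fun m (z : (ℕ → H) × (ℕ → ℕ)) => z.1 m) (by fun_prop) n a
    have hynn : ∀ a, Measurable fun z : (ℕ → H) × (ℕ → ℕ) => z.2 (nn a z) := fun a =>
      measurable_apply_nat (X := fun m (z : (ℕ → H) × (ℕ → ℕ)) => z.2 m) (by fun_prop) (hnn a)
    -- The cross term without the residual at `i`, cut off on `B i j`.
    let w : (ℕ → H) × (ℕ → ℕ) → ℝ := fun z => if nn i z = j ∨ nn j z = i then 0 else
      (if z.2 (nn i z) = l then 1 else 0) * ((if z.2 (nn j z) = l then 1 else 0) *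
        residual k g (z.1 j, z.2 j))
    have hw : Measurable w := by
      refine Measurable.ite (((hnn i) (measurableSet_singleton j)).union
        ((hnn j) (measurableSet_singleton i))) measurable_const ?_
      exact (measurable_ite_eq (hynn i) measurable_const).mul
        ((measurable_ite_eq (hynn j) measurable_const).mul (hres.comp (by fun_prop)))
    have hw1 : ∀ z, |w z| ≤ 1 := fun z => by
      simp only [w]
      by_cases h : nn i z = j ∨ nn j z = i
      · simp [h]
      · rw [if_neg h, abs_mul, abs_mul]
        exact mul_le_one₀ (hone _ _) (by positivity)
          (mul_le_one₀ (hone _ _) (abs_nonneg _) (hg.abs_residual_le _))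
    have hwi : ∀ x y c, w (x, Function.update y i c) = w (x, y) := fun x y c => by
      simp only [w, nn]
      by_cases h : nnIndex x n i = j ∨ nnIndex x n j = i
      · simp [h]
      · have h1 := (isNearestNeighbor_nnIndex x hn i).2.1
        push Not at h
        simp only [Function.update_of_ne h1, Function.update_of_ne h.2,
          Function.update_of_ne (Ne.symm hij)]
    refine (integral_congr_ae (Eventually.of_forall fun ω => ?_)).trans
      (integral_mul_residual_eq_zero hS hg i hw hw1 hwi)
    simp only [w, nn, B]
    by_cases h : nnIndex (fun m => X m ω) n i = j ∨ nnIndex (fun m => X m ω) n j = i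
    · rw [if_pos h, zero_mul, Set.indicator_of_notMem]
      simpa [hij, or_iff_not_imp_left] using h
    · rw [if_neg h, Set.indicator_of_mem]
      · ring
      · simpa [hij] using h
  · calc ∑ i ∈ Finset.range n, ∑ j ∈ Finset.range n, μ.real (B i j)
        ≤ ∑ i ∈ Finset.range n, ∑ j ∈ Finset.range n, (μ.real {_ω : Ω | i = j} +
          (μ.real {ω | nnIndex (fun m => X m ω) n i = j} +
            μ.real {ω | nnIndex (fun m => X m ω) n j = i})) :=
          Finset.sum_le_sum fun i _ => Finset.sum_le_sum fun j _ =>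
            (measureReal_union_le _ _).trans (add_le_add_right (measureReal_union_le _ _) _)
      _ = ∑ i ∈ Finset.range n, ∑ j ∈ Finset.range n, μ.real {_ω : Ω | i = j} +
          (∑ i ∈ Finset.range n, ∑ j ∈ Finset.range n,
            μ.real {ω | nnIndex (fun m => X m ω) n i = j} +
          ∑ j ∈ Finset.range n, ∑ i ∈ Finset.range n,
            μ.real {ω | nnIndex (fun m => X m ω) n j = i}) := by
          simp only [Finset.sum_add_distrib]
          rw [Finset.sum_comm (f := fun i j => μ.real {ω | nnIndex (fun m => X m ω) n j = i})]
      _ ≤ ∑ i ∈ Finset.range n, 1 + (∑ i ∈ Finset.range n, 1 + ∑ i ∈ Finset.range n, 1) := by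
          refine add_le_add (Finset.sum_le_sum fun i _ => ?_)
            (add_le_add (Finset.sum_le_sum fun i _ => ?_) (Finset.sum_le_sum fun i _ => ?_))
          · exact sum_measureReal_eq_le_one (N := fun _ => i) measurable_const _
          · exact sum_measureReal_eq_le_one (hN i) _
          · exact sum_measureReal_eq_le_one (hN i) _
      _ = 3 * n := by simp; ring

/-- When `i` and `j` have different neighbours, the two residuals involve different labels and the
remaining factors depend on the points only. -/
theorem integral_sum_mul_residual_nnIndex_sq_le (hS : IsIIDSample μ X Y) {l : ℕ} {g : H → ℝ}
    (hg : IsRegression μ (X 0) (Y 0) l g) {h : H → ℝ} (hh : Measurable h)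
    (hh1 : ∀ x, |h x| ≤ 1) {n : ℕ} (hn : 2 ≤ n) :
    ∫ ω, (∑ i ∈ Finset.range n, h (X i ω) * residual l g (X (nnIndex (fun m => X m ω) n i) ω,
      Y (nnIndex (fun m => X m ω) n i) ω)) ^ 2 ∂μ ≤
      ∑ i ∈ Finset.range n, ∑ j ∈ Finset.range n,
        μ.real {ω | nnIndex (fun m => X m ω) n i = nnIndex (fun m => X m ω) n j} := by
  have hN : ∀ i, Measurable fun ω => nnIndex (fun m => X m ω) n i :=
    measurable_nnIndex hS.measurable_left n
  have hres := measurable_residual (k := l) hg.measurable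
  refine integral_sum_sq_le ?_ ?_ ?_ ?_
  · exact fun i => (hh.comp (hS.measurable_left i)).mul (hres.comp
      ((measurable_apply_nat hS.measurable_left (hN i)).prodMk
        (measurable_apply_nat hS.measurable_right (hN i))))
  · intro i ω
    rw [abs_mul]
    exact mul_le_one₀ (hh1 _) (abs_nonneg _) (hg.abs_residual_le _)
  · exact fun i j => measurableSet_eq_fun (hN i) (hN j)
  · intro i _ j _
    let nn : ℕ → (ℕ → H) × (ℕ → ℕ) → ℕ := fun a z => nnIndex z.1 n a
    have hnn : ∀ a, Measurable (nn a) := fun a =>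
      measurable_nnIndex (X := fun m (z : (ℕ → H) × (ℕ → ℕ)) => z.1 m) (by fun_prop) n a
    -- Orthogonality needs a deterministic index, so the cross term is split over the values `a ≠ b`
    -- of the two neighbour indices.
    let w : ℕ → ℕ → (ℕ → H) × (ℕ → ℕ) → ℝ := fun a b z =>
      if nn i z = a ∧ nn j z = b ∧ a ≠ b then
        h (z.1 i) * (h (z.1 j) * residual l g (z.1 b, z.2 b)) else 0
    have hw : ∀ a b, Measurable (w a b) := fun a b => by
      refine Measurable.ite (((hnn i) (measurableSet_singleton a)).inter
        (((hnn j) (measurableSet_singleton b)).inter (MeasurableSet.const _))) ?_ measurable_const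
      exact (hh.comp (by fun_prop)).mul ((hh.comp (by fun_prop)).mul (hres.comp (by fun_prop)))
    have hw1 : ∀ a b z, |w a b z| ≤ 1 := fun a b z => by
      simp only [w]
      split_ifs
      · rw [abs_mul, abs_mul]
        exact mul_le_one₀ (hh1 _) (by positivity)
          (mul_le_one₀ (hh1 _) (abs_nonneg _) (hg.abs_residual_le _))
      · simp
    have hwi : ∀ a b x y c, w a b (x, Function.update y a c) = w a b (x, y) :=
      fun a b x y c => by
        simp only [w, nn]
        by_cases hab : a = b
        · simp [hab]
        · rw [Function.update_of_ne (Ne.symm hab)]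
    have hsum : ∀ ω, {ω | nnIndex (fun m => X m ω) n i = nnIndex (fun m => X m ω) n j}ᶜ.indicator
        (fun ω => h (X i ω) * residual l g (X (nnIndex (fun m => X m ω) n i) ω,
            Y (nnIndex (fun m => X m ω) n i) ω) *
          (h (X j ω) * residual l g (X (nnIndex (fun m => X m ω) n j) ω,
            Y (nnIndex (fun m => X m ω) n j) ω))) ω =
        ∑ a ∈ Finset.range n, ∑ b ∈ Finset.range n,
          w a b (fun m => X m ω, fun m => Y m ω) * residual l g (X a ω, Y a ω) := fun ω => by
      have hi := (isNearestNeighbor_nnIndex (fun m => X m ω) hn i).1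
      have hj := (isNearestNeighbor_nnIndex (fun m => X m ω) hn j).1
      rw [Finset.sum_eq_single_of_mem _ (Finset.mem_range.2 hi),
        Finset.sum_eq_single_of_mem _ (Finset.mem_range.2 hj)]
      · by_cases hij : nnIndex (fun m => X m ω) n i = nnIndex (fun m => X m ω) n j
        · rw [Set.indicator_of_notMem (by simpa using hij)]
          simp [w, nn, hij]
        · rw [Set.indicator_of_mem (by simpa using hij)]
          simp only [w, nn, ne_eq, hij, not_false_eq_true, and_self, if_true]
          ring
      · intro b _ hb
        simp [w, nn, Ne.symm hb]
      · intro a _ ha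
        simp [w, nn, Ne.symm ha]
    have hint : ∀ a b, Integrable (fun ω => w a b (fun m => X m ω, fun m => Y m ω) *
        residual l g (X a ω, Y a ω)) μ := fun a b => by
      have hXY : Measurable fun ω => ((fun m => X m ω, fun m => Y m ω) : (ℕ → H) × (ℕ → ℕ)) :=
        (measurable_pi_lambda _ hS.measurable_left).prodMk
          (measurable_pi_lambda _ hS.measurable_right)
      refine integrable_of_abs_le (C := 1) (((hw a b).comp hXY).mul (hres.comp
        ((hS.measurable_left a).prodMk (hS.measurable_right a)))) fun ω => ?_
      rw [abs_mul]
      exact mul_le_one₀ (hw1 _ _ _) (abs_nonneg _) (hg.abs_residual_le _)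
    simp_rw [hsum]
    rw [integral_finsetSum _ fun a _ => integrable_finsetSum _ fun b _ => hint a b]
    refine Finset.sum_eq_zero fun a _ => ?_
    rw [integral_finsetSum _ fun b _ => hint a b]
    exact Finset.sum_eq_zero fun b _ =>
      integral_mul_residual_eq_zero hS hg a (hw a b) (hw1 a b) (hwi a b)

end SecondMoment

/-! ### Exchangeability and recurrence of the sample points -/

section Geometry

variable {Ω H : Type*} [MeasurableSpace Ω] {μ : Measure Ω} [IsProbabilityMeasure μ]
  [MeasurableSpace H] {X : ℕ → Ω → H} {Y : ℕ → Ω → ℕ}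

omit [IsProbabilityMeasure μ] in
theorem IsIIDSample.iIndepFun_fst (hS : IsIIDSample μ X Y) : iIndepFun X μ :=
  hS.indep.comp (fun _ => Prod.fst) fun _ => measurable_fst

omit [IsProbabilityMeasure μ] in
theorem IsIIDSample.identDistrib_fst (hS : IsIIDSample μ X Y) (i : ℕ) :
    IdentDistrib (X i) (X 0) μ μ :=
  (hS.ident i).comp measurable_fst

omit [IsProbabilityMeasure μ] in
theorem IsIIDSample.identDistrib_perm (hS : IsIIDSample μ X Y) (σ : Equiv.Perm ℕ) :
    IdentDistrib (fun ω m => X (σ m) ω) (fun ω m => X m ω) μ μ := by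
  have hX := hS.measurable_left
  have h1 : Measurable fun ω m => X (σ m) ω := measurable_pi_lambda _ fun m => hX _
  have h2 : Measurable fun ω m => X m ω := measurable_pi_lambda _ fun m => hX _
  refine ⟨h1.aemeasurable, h2.aemeasurable, ?_⟩
  rw [hS.iIndepFun_fst.map_fun_eq_infinitePi_map₀ h2.aemeasurable,
    (hS.iIndepFun_fst.precomp σ.injective).map_fun_eq_infinitePi_map₀ h1.aemeasurable]
  congr 1
  funext m
  exact (hS.identDistrib_fst (σ m)).map_eq.trans (hS.identDistrib_fst m).map_eq.symm

theorem IsIIDSample.map_pair (hS : IsIIDSample μ X Y) {i j : ℕ} (hij : i ≠ j) :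
    μ.map (fun ω => (X i ω, X j ω)) = (μ.map (X 0)).prod (μ.map (X 0)) := by
  rw [(indepFun_iff_map_prod_eq_prod_map_map (hS.measurable_left i).aemeasurable
    (hS.measurable_left j).aemeasurable).1 (hS.iIndepFun_fst.indepFun hij),
    (hS.identDistrib_fst i).map_eq, (hS.identDistrib_fst j).map_eq]

/-- Either `B` has probability zero, or the next `M` points all miss it with probability `q ^ M`,
where `q < 1`. -/
theorem IsIIDSample.ae_exists_mem_of_mem (hS : IsIIDSample μ X Y) {B : Set H}
    (hB : MeasurableSet B) : ∀ᵐ ω ∂μ, X 0 ω ∈ B → ∃ m, m ≠ 0 ∧ X m ω ∈ B := by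
  have hX := hS.measurable_left
  by_cases h0 : μ (X 0 ⁻¹' B) = 0
  · have : ∀ᵐ ω ∂μ, X 0 ω ∉ B := measure_eq_zero_iff_ae_notMem.1 h0
    filter_upwards [this] with ω h1 h2 using absurd h2 h1
  · have hlt : μ (X 0 ⁻¹' Bᶜ) < 1 := by
      rw [Set.preimage_compl, prob_compl_eq_one_sub (hX 0 hB)]
      exact ENNReal.sub_lt_self ENNReal.one_ne_top one_ne_zero h0
    have hnull : μ {ω | ∀ m, m ≠ 0 → X m ω ∉ B} = 0 := by
      refine le_antisymm (ge_of_tendsto' (ENNReal.tendsto_pow_atTop_nhds_zero_of_lt_one hlt)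
        fun M => ?_) zero_le
      calc μ {ω | ∀ m, m ≠ 0 → X m ω ∉ B} ≤ μ (⋂ m ∈ Finset.Icc 1 M, X m ⁻¹' Bᶜ) := by
            refine measure_mono fun ω hω => ?_
            simp only [Set.mem_iInter]
            exact fun m hm => hω m (by simp at hm; omega)
        _ = ∏ m ∈ Finset.Icc 1 M, μ (X m ⁻¹' Bᶜ) :=
            hS.iIndepFun_fst.measure_inter_preimage_eq_mul _ fun _ _ => hB.compl
        _ = ∏ m ∈ Finset.Icc 1 M, μ (X 0 ⁻¹' Bᶜ) :=
            Finset.prod_congr rfl fun m _ => (hS.identDistrib_fst m).measure_mem_eq hB.compl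
        _ = μ (X 0 ⁻¹' Bᶜ) ^ M := by simp
    filter_upwards [measure_eq_zero_iff_ae_notMem.1 hnull] with ω hω _
    simpa using hω

end Geometry

/-! ### Neighbour distances and shared neighbours -/

section Metric

variable {Ω H : Type*} [MeasurableSpace Ω] {μ : Measure Ω} [IsProbabilityMeasure μ]
  [MetricSpace H] [TopologicalSpace.SeparableSpace H] [MeasurableSpace H] [BorelSpace H]
  {X : ℕ → Ω → H} {Y : ℕ → Ω → ℕ}

/-- By recurrence, almost surely every ball of a countable family (dense centres, radii `1 / (m +
1)`) that contains `X 0` contains a later point. Such balls of arbitrarily small radius exist around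
`X 0`. -/
theorem IsIIDSample.ae_tendsto_dist_nnIndex (hS : IsIIDSample μ X Y) :
    ∀ᵐ ω ∂μ, Tendsto (fun n => dist (X 0 ω) (X (nnIndex (fun m => X m ω) n 0) ω)) atTop (𝓝 0) := by
  obtain ⟨ω₀⟩ : Nonempty Ω := nonempty_of_isProbabilityMeasure μ
  have : Nonempty H := ⟨X 0 ω₀⟩
  have h : ∀ᵐ ω ∂μ, ∀ s m : ℕ, X 0 ω ∈ Metric.ball (TopologicalSpace.denseSeq H s) (1 / (m + 1)) →
      ∃ j, j ≠ 0 ∧ X j ω ∈ Metric.ball (TopologicalSpace.denseSeq H s) (1 / (m + 1)) := by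
    rw [ae_all_iff]; intro s
    rw [ae_all_iff]; intro m
    exact hS.ae_exists_mem_of_mem Metric.isOpen_ball.measurableSet
  filter_upwards [h] with ω hω
  rw [Metric.tendsto_atTop]
  intro ε hε
  obtain ⟨m, hm⟩ := exists_nat_one_div_lt (half_pos hε)
  obtain ⟨s, hs⟩ := (TopologicalSpace.denseRange_denseSeq H).exists_dist_lt (X 0 ω)
    (ε := 1 / ((m : ℝ) + 1)) (by positivity)
  obtain ⟨j, hj0, hj⟩ := hω s m (by simpa using hs)
  -- This ensures both `j < n` and `2 ≤ n`.
  refine ⟨j + 2, fun n hn => ?_⟩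
  have h1 := (isNearestNeighbor_nnIndex (fun m => X m ω) (by omega : 2 ≤ n) 0).2.2 j (by omega) hj0
  have h2 : dist (X 0 ω) (X j ω) < ε := by
    have := dist_triangle_right (X 0 ω) (X j ω) (TopologicalSpace.denseSeq H s)
    rw [Metric.mem_ball] at hj
    linarith
  rw [Real.dist_0_eq_abs, abs_of_nonneg dist_nonneg]
  exact h1.trans_lt h2

omit [IsProbabilityMeasure μ] in
-- The transposition of `0` and `i` preserves the law of the sequence of points and, neighbours
-- being unique, carries one pair to the other.
theorem IsIIDSample.identDistrib_nnIndex (hS : IsIIDSample μ X Y)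
    (hu : UniqueNearestNeighbors μ X) {n i : ℕ} (hn : 2 ≤ n) (hi : i < n) :
    IdentDistrib (fun ω => (X i ω, X (nnIndex (fun m => X m ω) n i) ω))
      (fun ω => (X 0 ω, X (nnIndex (fun m => X m ω) n 0) ω)) μ μ := by
  have hΦ : Measurable fun x : ℕ → H => (x 0, x (nnIndex x n 0)) :=
    Measurable.prodMk (by fun_prop) (measurable_apply_nat (X := fun m (x : ℕ → H) => x m)
      (by fun_prop) (measurable_nnIndex (X := fun m (x : ℕ → H) => x m) (by fun_prop) n 0))
  refine IdentDistrib.trans (IdentDistrib.of_ae_eq ?_ ?_)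
    ((hS.identDistrib_perm (Equiv.swap 0 i)).comp hΦ)
  · exact ((hS.measurable_left i).prodMk (measurable_apply_nat hS.measurable_left
      (measurable_nnIndex hS.measurable_left n i))).aemeasurable
  · filter_upwards [hu] with ω hω
    have := nnIndex_perm (x := fun m => X m ω) (σ := Equiv.swap 0 i) (i := 0) hn (fun m => by
      rw [Equiv.swap_apply_def]; split_ifs <;> omega) (by simpa using hω n hn i hi)
    simp only [Function.comp, Equiv.swap_apply_left] at this ⊢
    rw [this]

omit [IsProbabilityMeasure μ] in
-- At an atom the first three points would coincide with positive probability, giving point `0` two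
-- nearest neighbours when `n = 3`.
theorem IsIIDSample.nullSingletonClass (hS : IsIIDSample μ X Y) (hu : UniqueNearestNeighbors μ X) :
    NullSingletonClass (μ.map (X 0)) := by
  refine ⟨fun x => ?_⟩
  rw [Measure.map_apply (hS.measurable_left 0) (measurableSet_singleton x)]
  have h1 := hS.iIndepFun_fst.measure_inter_preimage_eq_mul (Finset.range 3)
    (sets := fun _ => {x}) fun _ _ => measurableSet_singleton x
  rw [Finset.prod_congr rfl fun m _ =>
    (hS.identDistrib_fst m).measure_mem_eq (measurableSet_singleton x), Finset.prod_const] at h1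
  have h2 : μ (⋂ i ∈ Finset.range 3, X i ⁻¹' {x}) = 0 := by
    refine measure_mono_null (fun ω hω => ?_) (ae_iff.1 hu)
    simp only [Set.mem_iInter, Finset.mem_range, Set.mem_preimage, Set.mem_singleton_iff] at hω
    intro hc
    have hnn : ∀ j < 3, j ≠ 0 → IsNearestNeighbor (fun m => X m ω) 3 0 j := fun j hj hj0 =>
      ⟨hj, hj0, fun m hm _ => by simp [hω 0 (by norm_num), hω j hj]⟩
    have := (hc 3 (by norm_num) 0 (by norm_num)).unique (hnn 1 (by norm_num) (by norm_num))
      (hnn 2 (by norm_num) (by norm_num))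
    omega
  rw [h2] at h1
  exact pow_eq_zero_iff (by simp) |>.1 h1.symm

/-- These sets decrease to the diagonal, which is null by Fubini because `ν` has no atoms. -/
theorem exists_measureReal_prod_dist_le_lt {ν : Measure H} [IsProbabilityMeasure ν] [NullSingletonClass ν]
    {η : ℝ} (hη : 0 < η) : ∃ ε > 0, (ν.prod ν).real {p | dist p.1 p.2 ≤ ε} < η := by
  have : SecondCountableTopology H := UniformSpace.secondCountable_of_separable H
  have hmeas : ∀ ε : ℝ, MeasurableSet {p : H × H | dist p.1 p.2 ≤ ε} := fun ε =>
    measurableSet_le (measurable_fst.dist measurable_snd) measurable_const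
  have hanti : Antitone fun m : ℕ => {p : H × H | dist p.1 p.2 ≤ 1 / ((m : ℝ) + 1)} :=
    fun a b hab p (hp : dist p.1 p.2 ≤ 1 / ((b : ℝ) + 1)) =>
      hp.trans (one_div_le_one_div_of_le (by positivity) (by gcongr))
  have h := tendsto_measure_iInter_atTop (μ := ν.prod ν)
    (fun m : ℕ => (hmeas (1 / ((m : ℝ) + 1))).nullMeasurableSet) hanti ⟨0, measure_ne_top _ _⟩
  have hI : ⋂ m : ℕ, {p : H × H | dist p.1 p.2 ≤ 1 / ((m : ℝ) + 1)} = {p | dist p.1 p.2 ≤ 0} := by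
    ext p
    simp only [Set.mem_iInter, Set.mem_ofPred_eq]
    exact ⟨fun hp => ge_of_tendsto' tendsto_one_div_add_atTop_nhds_zero_nat hp,
      fun hp m => hp.trans (by positivity)⟩
  have h0 : (ν.prod ν) {p | dist p.1 p.2 ≤ 0} = 0 := by
    rw [Measure.measure_prod_null (hmeas 0)]
    refine Eventually.of_forall fun x => ?_
    have : Prod.mk x ⁻¹' {p : H × H | dist p.1 p.2 ≤ 0} = {x} := by
      ext y; simp [eq_comm]
    simp only [this, measure_singleton, Pi.zero_apply]
  rw [hI, h0] at h
  obtain ⟨m, hm⟩ := (h.eventually (gt_mem_nhds (ENNReal.ofReal_pos.2 hη))).exists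
  refine ⟨1 / ((m : ℝ) + 1), by positivity, ?_⟩
  rw [measureReal_def]
  exact (ENNReal.lt_ofReal_iff_toReal_lt (measure_ne_top _ _)).1 hm

/-- If `i ≠ j` share a neighbour, then one of them is at distance at least `ε / 2` from it, or the
two points are within `ε` of each other. All three events have small probability, uniformly in `i`
and `j`. -/
theorem IsIIDSample.tendsto_sum_measureReal_nnIndex_eq (hS : IsIIDSample μ X Y)
    (hu : UniqueNearestNeighbors μ X) :
    Tendsto (fun n : ℕ => (1 / (n : ℝ)) ^ 2 * ∑ i ∈ Finset.range n, ∑ j ∈ Finset.range n,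
      μ.real {ω | nnIndex (fun m => X m ω) n i = nnIndex (fun m => X m ω) n j}) atTop (𝓝 0) := by
  have : SecondCountableTopology H := UniformSpace.secondCountable_of_separable H
  have := hS.nullSingletonClass hu
  have hX := hS.measurable_left
  have := Measure.isProbabilityMeasure_map (μ := μ) (hX 0).aemeasurable
  have hXN : ∀ n i, Measurable fun ω => X (nnIndex (fun m => X m ω) n i) ω := fun n i =>
    measurable_apply_nat hX (measurable_nnIndex hX n i)
  rw [Metric.tendsto_atTop]
  intro η hη
  -- Four shares of `η / 4`: two large neighbour distances, one close pair, and `1 / n` from the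
  -- diagonal.
  obtain ⟨ε, hε, hb⟩ := exists_measureReal_prod_dist_le_lt (ν := μ.map (X 0))
    (by positivity : 0 < η / 4)
  have hr := tendstoInMeasure_of_tendsto_ae (fun n => ((hX 0).dist (hXN n 0)).aestronglyMeasurable)
    hS.ae_tendsto_dist_nnIndex
  rw [tendstoInMeasure_iff_measureReal_dist] at hr
  have hr' := (hr (ε / 2) (by positivity)).eventually (gt_mem_nhds (by positivity : 0 < η / 4))
  have hn' := tendsto_one_div_atTop_nhds_zero_nat.eventually
    (gt_mem_nhds (by positivity : 0 < η / 4))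
  obtain ⟨n₀, hn₀⟩ := eventually_atTop.1 ((hr'.and hn').and (eventually_ge_atTop 2))
  refine ⟨n₀, fun n hn => ?_⟩
  obtain ⟨⟨ha, hn1⟩, hn2⟩ := hn₀ n hn
  simp only [Real.dist_0_eq_abs, abs_dist] at ha
  have hnpos : (0 : ℝ) < n := by positivity
  have hpair : ∀ i < n, ∀ j < n,
      μ.real {ω | nnIndex (fun m => X m ω) n i = nnIndex (fun m => X m ω) n j} ≤
        (if i = j then 1 else 0) + 3 * (η / 4) := by
    intro i hi j hj
    by_cases hij : i = j
    · rw [if_pos hij]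
      exact measureReal_le_one.trans (by linarith)
    have hrad : ∀ i < n, μ.real {ω | ε / 2 ≤ dist (X i ω) (X (nnIndex (fun m => X m ω) n i) ω)} <
        η / 4 := fun i hi => by
      have := (hS.identDistrib_nnIndex hu hn2 hi).measure_mem_eq
        (s := {p : H × H | ε / 2 ≤ dist p.1 p.2})
        (measurableSet_le measurable_const (measurable_fst.dist measurable_snd))
      rw [measureReal_def]
      refine (congrArg ENNReal.toReal this).trans_lt ha
    have hclose : μ.real {ω | dist (X i ω) (X j ω) ≤ ε} < η / 4 := by
      rw [← hS.map_pair hij, map_measureReal_apply ((hX i).prodMk (hX j))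
        (measurableSet_le (measurable_fst.dist measurable_snd) measurable_const)] at hb
      exact hb
    have hsub : {ω | nnIndex (fun m => X m ω) n i = nnIndex (fun m => X m ω) n j} ⊆
        {ω | ε / 2 ≤ dist (X i ω) (X (nnIndex (fun m => X m ω) n i) ω)} ∪
        ({ω | ε / 2 ≤ dist (X j ω) (X (nnIndex (fun m => X m ω) n j) ω)} ∪
          {ω | dist (X i ω) (X j ω) ≤ ε}) := by
      intro ω hω
      by_contra hc
      simp only [Set.mem_union, Set.mem_ofPred_eq, not_or, not_le] at hc hω
      have := dist_triangle_right (X i ω) (X j ω) (X (nnIndex (fun m => X m ω) n i) ω)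
      rw [← hω] at hc
      linarith [hc.1, hc.2.1, hc.2.2]
    have h1 := (measureReal_mono hsub (measure_ne_top μ _)).trans (measureReal_union_le _ _)
    have h2 := measureReal_union_le (μ := μ)
      {ω | ε / 2 ≤ dist (X j ω) (X (nnIndex (fun m => X m ω) n j) ω)}
      {ω | dist (X i ω) (X j ω) ≤ ε}
    rw [if_neg hij]
    linarith [hrad i hi, hrad j hj]
  rw [Real.dist_0_eq_abs, abs_of_nonneg (mul_nonneg (by positivity)
    (Finset.sum_nonneg fun i _ => Finset.sum_nonneg fun j _ => measureReal_nonneg))]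
  calc (1 / (n : ℝ)) ^ 2 * ∑ i ∈ Finset.range n, ∑ j ∈ Finset.range n,
      μ.real {ω | nnIndex (fun m => X m ω) n i = nnIndex (fun m => X m ω) n j}
      ≤ (1 / (n : ℝ)) ^ 2 * ∑ i ∈ Finset.range n, ∑ j ∈ Finset.range n,
          ((if i = j then 1 else 0) + 3 * (η / 4)) := by
        refine mul_le_mul_of_nonneg_left (Finset.sum_le_sum fun i hi => Finset.sum_le_sum
          fun j hj => hpair i (Finset.mem_range.1 hi) j (Finset.mem_range.1 hj)) (by positivity)
    _ = (1 / (n : ℝ)) ^ 2 * (n + n ^ 2 * (3 * (η / 4))) := by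
        have : ∀ i ∈ Finset.range n, ∑ j ∈ Finset.range n,
            ((if i = j then (1 : ℝ) else 0) + 3 * (η / 4)) = 1 + n * (3 * (η / 4)) := fun i hi => by
          rw [Finset.sum_add_distrib, Finset.sum_ite_eq, if_pos hi]; simp
        rw [Finset.sum_congr rfl this]
        simp only [Finset.sum_const, Finset.card_range, nsmul_eq_mul]
        ring
    _ = 1 / n + 3 * (η / 4) := by field_simp
    _ < η := by linarith

end Metric

/-! ### Consistency of the empirical table -/

section Consistency

variable {Ω H : Type*} [MeasurableSpace Ω] {μ : Measure Ω} [IsProbabilityMeasure μ]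
  [MetricSpace H] [TopologicalSpace.SeparableSpace H] [MeasurableSpace H] [BorelSpace H]
  {X : ℕ → Ω → H} {Y : ℕ → Ω → ℕ}

omit [IsProbabilityMeasure μ] in
theorem IsIIDSample.measurable_left_nnIndex (hS : IsIIDSample μ X Y) (n i : ℕ) :
    Measurable fun ω => X (nnIndex (fun m => X m ω) n i) ω :=
  measurable_apply_nat hS.measurable_left (measurable_nnIndex hS.measurable_left n i)

omit [IsProbabilityMeasure μ] in
theorem IsIIDSample.measurable_right_nnIndex (hS : IsIIDSample μ X Y) (n i : ℕ) :
    Measurable fun ω => Y (nnIndex (fun m => X m ω) n i) ω :=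
  measurable_apply_nat hS.measurable_right (measurable_nnIndex hS.measurable_left n i)

theorem tendsto_mean_residual_mul (hS : IsIIDSample μ X Y) {k : ℕ} {g : H → ℝ}
    (hg : IsRegression μ (X 0) (Y 0) k g) (l : ℕ) :
    Tendsto (fun z : ℕ × Ω => 1 / (z.1 : ℝ) * ∑ i ∈ Finset.range z.1,
      residual k g (X i z.2, Y i z.2) *
        if Y (nnIndex (fun m => X m z.2) z.1 i) z.2 = l then 1 else 0) (inMeasure μ) (𝓝 0) := by
  refine tendsto_inMeasure_of_tendsto_integral_sq (f := fun (n : ℕ) ω => 1 / (n : ℝ) *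
    ∑ i ∈ Finset.range n, residual k g (X i ω, Y i ω) *
      if Y (nnIndex (fun m => X m ω) n i) ω = l then 1 else 0) (fun n => ?_) ?_
  · have hm : ∀ i, Measurable fun ω => residual k g (X i ω, Y i ω) *
        if Y (nnIndex (fun m => X m ω) n i) ω = l then 1 else 0 := fun i =>
      ((measurable_residual hg.measurable).comp
        ((hS.measurable_left i).prodMk (hS.measurable_right i))).mul
        (measurable_ite_eq (hS.measurable_right_nnIndex n i) measurable_const)
    refine integrable_of_abs_le (((Finset.measurable_sum _ fun i _ => hm i).const_mul _).pow_const 2)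
      (C := (|1 / (n : ℝ)| * ∑ i ∈ Finset.range n, 1) ^ 2) fun ω => ?_
    rw [abs_pow, abs_mul]
    refine pow_le_pow_left₀ (by positivity) (mul_le_mul_of_nonneg_left
      ((Finset.abs_sum_le_sum_abs _ _).trans (Finset.sum_le_sum fun i _ => ?_)) (by positivity)) 2
    rw [abs_mul]
    exact mul_le_one₀ (hg.abs_residual_le _) (abs_nonneg _) (by split_ifs <;> simp)
  · have hlim : Tendsto (fun n : ℕ => 3 * (1 / (n : ℝ))) atTop (𝓝 0) := by
      simpa using tendsto_one_div_atTop_nhds_zero_nat.const_mul (3 : ℝ)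
    refine squeeze_zero' (Eventually.of_forall fun n => integral_nonneg fun ω => sq_nonneg _) ?_ hlim
    filter_upwards [eventually_ge_atTop 2] with n hn
    simp_rw [mul_pow]
    rw [integral_const_mul]
    have hpos : (0 : ℝ) < n := by positivity
    calc (1 / (n : ℝ)) ^ 2 * _ ≤ (1 / (n : ℝ)) ^ 2 * (3 * n) :=
          mul_le_mul_of_nonneg_left (integral_sum_residual_mul_sq_le hS hg l hn) (by positivity)
      _ = 3 * (1 / n) := by field_simp

theorem tendsto_mean_mul_residual_nnIndex (hS : IsIIDSample μ X Y)
    (hu : UniqueNearestNeighbors μ X) {l : ℕ} {g h : H → ℝ}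
    (hg : IsRegression μ (X 0) (Y 0) l g) (hh : Measurable h) (hh1 : ∀ x, |h x| ≤ 1) :
    Tendsto (fun z : ℕ × Ω => 1 / (z.1 : ℝ) * ∑ i ∈ Finset.range z.1,
      h (X i z.2) * residual l g (X (nnIndex (fun m => X m z.2) z.1 i) z.2,
        Y (nnIndex (fun m => X m z.2) z.1 i) z.2)) (inMeasure μ) (𝓝 0) := by
  refine tendsto_inMeasure_of_tendsto_integral_sq (f := fun (n : ℕ) ω => 1 / (n : ℝ) *
    ∑ i ∈ Finset.range n, h (X i ω) * residual l g (X (nnIndex (fun m => X m ω) n i) ω,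
        Y (nnIndex (fun m => X m ω) n i) ω)) (fun n => ?_) ?_
  · have hm : ∀ i, Measurable fun ω => h (X i ω) *
        residual l g (X (nnIndex (fun m => X m ω) n i) ω,
          Y (nnIndex (fun m => X m ω) n i) ω) := fun i =>
      (hh.comp (hS.measurable_left i)).mul ((measurable_residual hg.measurable).comp
        ((hS.measurable_left_nnIndex n i).prodMk (hS.measurable_right_nnIndex n i)))
    refine integrable_of_abs_le (((Finset.measurable_sum _ fun i _ => hm i).const_mul _).pow_const 2)
      (C := (|1 / (n : ℝ)| * ∑ i ∈ Finset.range n, 1) ^ 2) fun ω => ?_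
    rw [abs_pow, abs_mul]
    refine pow_le_pow_left₀ (by positivity) (mul_le_mul_of_nonneg_left
      ((Finset.abs_sum_le_sum_abs _ _).trans (Finset.sum_le_sum fun i _ => ?_)) (by positivity)) 2
    rw [abs_mul]
    exact mul_le_one₀ (hh1 _) (abs_nonneg _) (hg.abs_residual_le _)
  · refine squeeze_zero' (Eventually.of_forall fun n => integral_nonneg fun ω => sq_nonneg _) ?_
      (hS.tendsto_sum_measureReal_nnIndex_eq hu)
    filter_upwards [eventually_ge_atTop 2] with n hn
    simp_rw [mul_pow]
    rw [integral_const_mul]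
    exact mul_le_mul_of_nonneg_left (integral_sum_mul_residual_nnIndex_sq_le hS hg hh hh1 hn)
      (by positivity)

/-- By exchangeability, the mean of the averaged absolute differences equals the single expectation
at index `0` that `hc` controls. -/
theorem tendsto_mean_mul_sub_nnIndex (hS : IsIIDSample μ X Y)
    (hu : UniqueNearestNeighbors μ X) {g h : H → ℝ} (hg1 : ∀ x, |g x| ≤ 1)
    (hh : Measurable h) (hh1 : ∀ x, |h x| ≤ 1)
    (hc : Tendsto (fun n => ∫ ω, |h (X (nnIndex (fun m => X m ω) n 0) ω) - h (X 0 ω)| ∂μ)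
      atTop (𝓝 0)) :
    Tendsto (fun z : ℕ × Ω => 1 / (z.1 : ℝ) * ∑ i ∈ Finset.range z.1, g (X i z.2) *
      (h (X (nnIndex (fun m => X m z.2) z.1 i) z.2) - h (X i z.2))) (inMeasure μ) (𝓝 0) := by
  have hm : ∀ n i, Measurable fun ω =>
      |h (X (nnIndex (fun m => X m ω) n i) ω) - h (X i ω)| := fun n i => by
    have h1 := hh.comp (hS.measurable_left_nnIndex n i)
    have h2 := hh.comp (hS.measurable_left i)
    exact continuous_abs.measurable.comp (h1.sub h2)
  have hint : ∀ n i, Integrable (fun ω =>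
      |h (X (nnIndex (fun m => X m ω) n i) ω) - h (X i ω)|) μ := fun n i =>
    integrable_of_abs_le (hm n i) (C := 2) fun ω => by
      rw [abs_abs]
      refine (abs_sub _ _).trans ?_
      linarith [hh1 (X (nnIndex (fun m => X m ω) n i) ω), hh1 (X i ω)]
  have key : Tendsto (fun z : ℕ × Ω => 1 / (z.1 : ℝ) * ∑ i ∈ Finset.range z.1,
      |h (X (nnIndex (fun m => X m z.2) z.1 i) z.2) - h (X i z.2)|) (inMeasure μ) (𝓝 0) := by
    refine tendsto_inMeasure_of_tendsto_integral (f := fun (n : ℕ) ω => 1 / (n : ℝ) *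
      ∑ i ∈ Finset.range n, |h (X (nnIndex (fun m => X m ω) n i) ω) - h (X i ω)|)
      (fun n => (integrable_finsetSum _ fun i _ => hint n i).const_mul _)
      (fun n ω => by positivity) (hc.congr' ?_)
    filter_upwards [eventually_ge_atTop 2] with n hn
    have hpos : (0 : ℝ) < n := by positivity
    rw [integral_const_mul, integral_finsetSum _ fun i _ => hint n i]
    have : ∀ i ∈ Finset.range n,
        ∫ ω, |h (X (nnIndex (fun m => X m ω) n i) ω) - h (X i ω)| ∂μ =
          ∫ ω, |h (X (nnIndex (fun m => X m ω) n 0) ω) - h (X 0 ω)| ∂μ := fun i hi =>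
      ((hS.identDistrib_nnIndex hu hn (Finset.mem_range.1 hi)).comp
        (u := fun p : H × H => |h p.2 - h p.1|) (by fun_prop)).integral_eq
    rw [Finset.sum_congr rfl this]
    simp
    field_simp
  refine squeeze_zero_norm (fun z => ?_) key
  rw [Real.norm_eq_abs, abs_mul, abs_of_nonneg (by positivity : 0 ≤ 1 / (z.1 : ℝ))]
  refine mul_le_mul_of_nonneg_left ((Finset.abs_sum_le_sum_abs _ _).trans
    (Finset.sum_le_sum fun i _ => ?_)) (by positivity)
  rw [abs_mul]
  exact mul_le_of_le_one_left (abs_nonneg _) (hg1 _)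

omit [MetricSpace H] [TopologicalSpace.SeparableSpace H] [BorelSpace H] in
theorem tendsto_mean_inMeasure (hS : IsIIDSample μ X Y) {φ : H → ℝ} (hφ : Measurable φ) {C : ℝ}
    (hC : ∀ x, |φ x| ≤ C) :
    Tendsto (fun z : ℕ × Ω => 1 / (z.1 : ℝ) * ∑ i ∈ Finset.range z.1, φ (X i z.2)) (inMeasure μ)
      (𝓝 (∫ ω, φ (X 0 ω) ∂μ)) := by
  have hX := hS.measurable_left
  have h := strong_law_ae_real (μ := μ) (fun i ω => φ (X i ω))
    (integrable_of_abs_le (hφ.comp (hX 0)) fun ω => hC _)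
    (fun i j hij => (hS.iIndepFun_fst.indepFun hij).comp hφ hφ)
    (fun i => (hS.identDistrib_fst i).comp hφ)
  refine (tendstoInMeasure_const_iff (f := fun (n : ℕ) ω => 1 / (n : ℝ) *
    ∑ i ∈ Finset.range n, φ (X i ω))).1 (tendstoInMeasure_of_tendsto_ae (fun n => ?_) ?_)
  · exact ((Finset.measurable_sum _ fun i _ => hφ.comp (hX i)).const_mul _).aestronglyMeasurable
  · filter_upwards [h] with ω hω
    refine hω.congr fun n => ?_
    ring

theorem tendsto_pHat (hS : IsIIDSample μ X Y) (hu : UniqueNearestNeighbors μ X) {k l : ℕ}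
    {g h : H → ℝ} (hg : IsRegression μ (X 0) (Y 0) k g) (hh : IsRegression μ (X 0) (Y 0) l h)
    (hc : Tendsto (fun n => ∫ ω, |h (X (nnIndex (fun m => X m ω) n 0) ω) - h (X 0 ω)| ∂μ)
      atTop (𝓝 0)) :
    Tendsto (fun z : ℕ × Ω => pHat (fun m => X m z.2) (fun m => Y m z.2) z.1 k l) (inMeasure μ)
      (𝓝 (∫ ω, g (X 0 ω) * h (X 0 ω) ∂μ)) := by
  have hg1 : ∀ x, |g x| ≤ 1 := fun x => by
    rw [abs_of_nonneg (hg.nonneg x)]; exact hg.le_one x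
  have hh1 : ∀ x, |h x| ≤ 1 := fun x => by
    rw [abs_of_nonneg (hh.nonneg x)]; exact hh.le_one x
  have hsum := (((tendsto_mean_residual_mul hS hg l).add
    (tendsto_mean_mul_residual_nnIndex hS hu hh hg.measurable hg1)).add
    (tendsto_mean_mul_sub_nnIndex hS hu hg1 hh.measurable hh1 hc)).add
    (tendsto_mean_inMeasure hS (φ := fun x => g x * h x) (hg.measurable.mul hh.measurable) (C := 1)
      fun x => by rw [abs_mul]; exact mul_le_one₀ (hg1 x) (abs_nonneg _) (hh1 x))
  simp only [zero_add] at hsum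
  refine hsum.congr fun z => ?_
  rw [pHat, ← mul_add, ← mul_add, ← mul_add, ← Finset.sum_add_distrib, ← Finset.sum_add_distrib,
    ← Finset.sum_add_distrib]
  refine congrArg _ (Finset.sum_congr rfl fun i _ => ?_)
  simp only [residual, ite_and]
  split_ifs <;> ring

end Consistency

/-! ### Conditional probabilities, truncated so that bounds hold everywhere -/

/-- `q 1, …, q K` are nonnegative with sum `1`. -/
def IsProbVector (K : ℕ) (q : ℕ → ℝ) : Prop :=
  (∀ k ∈ Finset.Icc 1 K, 0 ≤ q k) ∧ ∑ k ∈ Finset.Icc 1 K, q k = 1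

/-- `Q k` truncated to values in `[0, 1]`. -/
def clip {H : Type*} (Q : ℕ → H → ℝ) (k : ℕ) (x : H) : ℝ := max 0 (min 1 (Q k x))

theorem clip_nonneg {H : Type*} (Q : ℕ → H → ℝ) (k : ℕ) (x : H) : 0 ≤ clip Q k x :=
  le_max_left _ _

theorem clip_le_one {H : Type*} (Q : ℕ → H → ℝ) (k : ℕ) (x : H) : clip Q k x ≤ 1 :=
  max_le zero_le_one (min_le_left _ _)

theorem measurable_clip {H : Type*} [MeasurableSpace H] {Q : ℕ → H → ℝ} {k : ℕ}
    (h : Measurable (Q k)) : Measurable (clip Q k) :=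
  measurable_const.max (measurable_const.min h)

theorem abs_clip_sub_clip_le_one {H : Type*} (Q : ℕ → H → ℝ) (k : ℕ) (x y : H) :
    |clip Q k x - clip Q k y| ≤ 1 := by
  rw [abs_le]
  constructor <;>
    linarith [clip_nonneg Q k x, clip_nonneg Q k y, clip_le_one Q k x, clip_le_one Q k y]

theorem clip_eq {H : Type*} {Q : ℕ → H → ℝ} {K : ℕ} {x : H}
    (hx : IsProbVector K fun k => Q k x) {k : ℕ} (hk : k ∈ Finset.Icc 1 K) :
    clip Q k x = Q k x := by
  have h1 : Q k x ≤ 1 := hx.2 ▸ Finset.single_le_sum (f := fun k => Q k x) hx.1 hk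
  rw [clip, min_eq_right h1, max_eq_right (hx.1 k hk)]

section CondProb

variable {Ω H : Type*} [MeasurableSpace Ω] {μ : Measure Ω} [IsProbabilityMeasure μ]
  [mH : MeasurableSpace H] {X : Ω → H} {Y : Ω → ℕ} {K : ℕ} {Q : ℕ → H → ℝ}

theorem IsCondProb.ae_isProbVector (hQ : IsCondProb μ X Y K Q) (hX : Measurable X)
    (hY : Measurable Y) (hYK : ∀ ω, Y ω ∈ Finset.Icc 1 K) :
    ∀ᵐ x ∂μ.map X, IsProbVector K fun k => Q k x := by
  have hint : ∀ k, Integrable ((Y ⁻¹' {k}).indicator fun _ => (1 : ℝ)) μ := fun k =>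
    (integrable_const _).indicator (hY (measurableSet_singleton k))
  refine Eventually.and ?_ ?_
  · rw [Filter.eventually_all_finset]
    intro k hk
    rw [ae_map_iff hX.aemeasurable (measurableSet_le measurable_const (hQ k hk).1)]
    have h0 : 0 ≤ᵐ[μ] μ[(Y ⁻¹' {k}).indicator (fun _ => (1 : ℝ)) | mH.comap X] :=
      condExp_nonneg (Eventually.of_forall fun ω =>
        Set.indicator_nonneg (fun _ _ => zero_le_one) ω)
    filter_upwards [(hQ k hk).2, h0] with ω h1 h2
    rw [h1]
    exact h2
  · rw [ae_map_iff hX.aemeasurable (measurableSet_eq_fun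
      (Finset.measurable_sum _ fun k hk => (hQ k hk).1) measurable_const)]
    have hsum : ∑ k ∈ Finset.Icc 1 K, (Y ⁻¹' {k}).indicator (fun _ => (1 : ℝ)) = fun _ => 1 := by
      funext ω
      rw [Finset.sum_apply, Finset.sum_eq_single_of_mem _ (hYK ω)]
      · simp
      · intro b _ hb
        simp [Ne.symm hb]
    have hce := condExp_finsetSum (fun k (_ : k ∈ Finset.Icc 1 K) => hint k) (mH.comap X)
    rw [hsum, condExp_const hX.comap_le] at hce
    have hall : ∀ᵐ ω ∂μ, ∀ k ∈ Finset.Icc 1 K,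
        Q k (X ω) = (μ[(Y ⁻¹' {k}).indicator (fun _ => (1 : ℝ)) | mH.comap X]) ω :=
      (Filter.eventually_all_finset _).2 fun k hk => (hQ k hk).2
    filter_upwards [hall, hce] with ω h1 h2
    rw [Finset.sum_congr rfl h1, ← Finset.sum_apply]
    exact h2.symm

/-- Orthogonality is the pull-out property of conditional expectation; truncation changes `Q k` only
on a null set of the law of `X`. -/
theorem IsCondProb.isRegression_clip (hQ : IsCondProb μ X Y K Q) (hX : Measurable X)
    (hY : Measurable Y) (hYK : ∀ ω, Y ω ∈ Finset.Icc 1 K) {k : ℕ} (hk : k ∈ Finset.Icc 1 K) :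
    IsRegression μ X Y k (clip Q k) := by
  have hm := measurable_clip (hQ k hk).1
  refine ⟨hm, clip_nonneg Q k, clip_le_one Q k, fun φ hφ ⟨C, hC⟩ => ?_⟩
  have hind : ∀ ω, (if Y ω = k then (1 : ℝ) else 0) = (Y ⁻¹' {k}).indicator (fun _ => 1) ω :=
    fun ω => by by_cases h : Y ω = k <;> simp [h]
  have hmi : Measurable ((Y ⁻¹' {k}).indicator fun _ => (1 : ℝ)) :=
    measurable_const.indicator (hY (measurableSet_singleton k))
  have hi1 : ∀ ω, |(Y ⁻¹' {k}).indicator (fun _ => (1 : ℝ)) ω| ≤ 1 := fun ω => by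
    rw [← hind]; split_ifs <;> simp
  have hint1 : Integrable ((φ ∘ X) * (Y ⁻¹' {k}).indicator fun _ => (1 : ℝ)) μ :=
    integrable_of_abs_le ((hφ.comp hX).mul hmi) (C := C) fun ω => by
      rw [Pi.mul_apply, abs_mul]
      exact (mul_le_of_le_one_right (abs_nonneg _) (hi1 ω)).trans (hC _)
  have hint2 : Integrable (fun ω => φ (X ω) * clip Q k (X ω)) μ :=
    integrable_of_abs_le ((hφ.comp hX).mul (hm.comp hX)) (C := C) fun ω => by
      rw [abs_mul, abs_of_nonneg (clip_nonneg Q k _)]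
      exact (mul_le_of_le_one_right (abs_nonneg _) (clip_le_one Q k _)).trans (hC _)
  have hpull := condExp_mul_of_stronglyMeasurable_left (m := mH.comap X)
    (hφ.comp (comap_measurable X)).stronglyMeasurable hint1 (integrable_of_abs_le hmi hi1)
  simp_rw [mul_sub, hind]
  refine (integral_sub hint1 hint2).trans (sub_eq_zero.2 ?_)
  refine (integral_condExp hX.comap_le).symm.trans (integral_congr_ae ?_)
  filter_upwards [hpull, (hQ k hk).2, ae_of_ae_map hX.aemeasurable
    (hQ.ae_isProbVector hX hY hYK)] with ω h1 h2 h3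
  rw [h1, clip_eq h3 hk, h2]
  rfl

end CondProb

/-! ### The quantile map under the uniform law -/

section Quantile

variable {H : Type*} {K : ℕ} {Q : ℕ → H → ℝ}

instance : IsProbabilityMeasure uniform01 := ⟨by simp [uniform01]⟩

theorem quantileMap_eq_iff {x : H} (hx : IsProbVector K fun k => Q k x) {k : ℕ}
    (hk : k ∈ Finset.Icc 1 K) {u : ℝ} (hu : 0 ≤ u) :
    quantileMap K Q x u = k ↔
      ∑ j ∈ Finset.Icc 1 (k - 1), Q j x ≤ u ∧ u < ∑ j ∈ Finset.Icc 1 k, Q j x := by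
  have hk' := Finset.mem_Icc.1 hk
  constructor
  · intro h
    have hne : {k : ℕ | k ∈ Finset.Icc 1 K ∧ u < ∑ j ∈ Finset.Icc 1 k, Q j x}.Nonempty := by
      -- An empty set would give the default value `0`, which differs from `k ≥ 1`.
      by_contra hc
      rw [Set.not_nonempty_iff_eq_empty] at hc
      rw [quantileMap, hc, Nat.sInf_empty] at h
      omega
    have hmem := Nat.sInf_mem hne
    rw [← quantileMap, h] at hmem
    refine ⟨not_lt.1 fun hlt => ?_, hmem.2⟩
    -- For `k = 1` the index `k - 1` is outside `{1, …, K}`, but the lower partial sum is empty and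
    -- `0 ≤ u` suffices.
    by_cases h1 : k = 1
    · subst h1
      simp at hlt
      linarith
    · have := Nat.notMem_of_lt_sInf (s := {k : ℕ | k ∈ Finset.Icc 1 K ∧
        u < ∑ j ∈ Finset.Icc 1 k, Q j x}) (m := k - 1) (by rw [← quantileMap, h]; omega)
      exact this ⟨Finset.mem_Icc.2 (by omega), hlt⟩
  · rintro ⟨h1, h2⟩
    refine le_antisymm (Nat.sInf_le ⟨hk, h2⟩) (not_lt.1 fun hlt => ?_)
    have hmem := Nat.sInf_mem (s := {k : ℕ | k ∈ Finset.Icc 1 K ∧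
      u < ∑ j ∈ Finset.Icc 1 k, Q j x}) ⟨k, hk, h2⟩
    rw [← quantileMap] at hmem
    have hle : ∑ j ∈ Finset.Icc 1 (quantileMap K Q x u), Q j x ≤
        ∑ j ∈ Finset.Icc 1 (k - 1), Q j x := by
      have hlt' : quantileMap K Q x u < k := hlt
      refine Finset.sum_le_sum_of_subset_of_nonneg (Finset.Icc_subset_Icc_right (by omega))
        fun j hj _ => hx.1 j ?_
      simp only [Finset.mem_Icc] at hj ⊢
      omega
    linarith [hmem.2]

theorem uniform01_real_quantileMap {x : H} (hx : IsProbVector K fun k => Q k x) {k : ℕ}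
    (hk : k ∈ Finset.Icc 1 K) : uniform01.real {u | quantileMap K Q x u = k} = Q k x := by
  have hk' := Finset.mem_Icc.1 hk
  set a := ∑ j ∈ Finset.Icc 1 (k - 1), Q j x with ha
  set b := ∑ j ∈ Finset.Icc 1 k, Q j x with hb
  have ha0 : 0 ≤ a := Finset.sum_nonneg fun j hj => hx.1 j (by
    simp only [Finset.mem_Icc] at hj ⊢; omega)
  have hab : b = a + Q k x := by
    obtain ⟨m, rfl⟩ : ∃ m, k = m + 1 := ⟨k - 1, by omega⟩
    rw [hb, Finset.sum_Icc_succ_top (by omega), ha, Nat.add_sub_cancel]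
  have hb1 : b ≤ 1 := by
    rw [← hx.2]
    exact Finset.sum_le_sum_of_subset_of_nonneg (Finset.Icc_subset_Icc_right hk'.2)
      fun j hj _ => hx.1 j hj
  have hQ0 := hx.1 k hk
  have hset : {u | quantileMap K Q x u = k} ∩ Set.Ioo 0 1 =
      Set.Ico a b ∩ Set.Ioo 0 1 := by
    ext u
    simp only [Set.mem_inter_iff, Set.mem_ofPred_eq, and_congr_left_iff]
    exact fun hu => quantileMap_eq_iff hx hk hu.1.le
  rw [measureReal_def, uniform01, Measure.restrict_apply' measurableSet_Ioo, hset]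
  have hvol : volume (Set.Ico a b ∩ Set.Ioo 0 1) = ENNReal.ofReal (b - a) := by
    refine le_antisymm ((measure_mono Set.inter_subset_left).trans_eq Real.volume_Ico) ?_
    rw [← Real.volume_Ioo]
    exact measure_mono fun u hu => ⟨⟨hu.1.le, hu.2⟩, ha0.trans_lt hu.1, hu.2.trans_le hb1⟩
  rw [hvol, hab, add_sub_cancel_left, ENNReal.toReal_ofReal hQ0]

/-- The coupling inequality: a common `u` realises both label distributions, so their masses differ
by at most the probability of disagreement. -/
theorem abs_sub_le_uniform01_real {x y : H} (hx : IsProbVector K fun k => Q k x)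
    (hy : IsProbVector K fun k => Q k y) {k : ℕ} (hk : k ∈ Finset.Icc 1 K) :
    |Q k x - Q k y| ≤ uniform01.real {u | quantileMap K Q x u ≠ quantileMap K Q y u} := by
  have key : ∀ x y : H, uniform01.real {u | quantileMap K Q x u = k} ≤
      uniform01.real {u | quantileMap K Q y u = k} +
        uniform01.real {u | quantileMap K Q x u ≠ quantileMap K Q y u} := fun x y => by
    refine (measureReal_mono (fun u hu => ?_) (measure_ne_top _ _)).trans
      (measureReal_union_le _ _)
    by_cases h : quantileMap K Q x u = quantileMap K Q y u
    · exact Or.inl (h.symm.trans hu)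
    · exact Or.inr h
  have h1 := key x y
  have h2 := key y x
  simp_rw [ne_comm (a := quantileMap K Q y _)] at h2
  rw [uniform01_real_quantileMap hx hk, uniform01_real_quantileMap hy hk] at h1 h2
  rw [abs_le]
  constructor <;> linarith

end Quantile

/-! ### The population table as moments of the conditional probabilities -/

section Coupling

theorem measureReal_prod_eq_integral {α β : Type*} [MeasurableSpace α] [MeasurableSpace β]
    {μ : Measure α} {ν : Measure β} [IsProbabilityMeasure μ] [IsProbabilityMeasure ν]
    {s : Set (α × β)} (hs : MeasurableSet s) :
    (μ.prod ν).real s = ∫ x, ν.real (Prod.mk x ⁻¹' s) ∂μ := by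
  simp only [measureReal_def]
  rw [integral_toReal (measurable_measure_prodMk_left hs).aemeasurable
    (Eventually.of_forall fun _ => measure_lt_top _ _), Measure.prod_apply hs]

variable {H : Type*} [MeasurableSpace H] {ν : Measure H} [IsProbabilityMeasure ν]
  {K : ℕ} {Q : ℕ → H → ℝ}

theorem couplingLaw_real_pair (hQm : ∀ k ∈ Finset.Icc 1 K, Measurable (Q k))
    (hQ : ∀ᵐ x ∂ν, IsProbVector K fun k => Q k x) {i j : ℕ} (hi : i ∈ Finset.Icc 1 K)
    (hj : j ∈ Finset.Icc 1 K) :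
    (couplingLaw ν).real {z | quantileMap K Q z.1 z.2.1 = i ∧ quantileMap K Q z.1 z.2.2 = j} =
      ∫ x, clip Q i x * clip Q j x ∂ν := by
  have hm := measurable_quantileMap hQm
  rw [couplingLaw, measureReal_prod_eq_integral]
  · refine integral_congr_ae ?_
    filter_upwards [hQ] with x hx
    rw [clip_eq hx hi, clip_eq hx hj, ← uniform01_real_quantileMap hx hi,
      ← uniform01_real_quantileMap hx hj, ← measureReal_prod_prod]
    rfl
  · exact ((hm.comp (by fun_prop : Measurable fun z : H × ℝ × ℝ => (z.1, z.2.1)))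
      (measurableSet_singleton i)).inter
      ((hm.comp (by fun_prop : Measurable fun z : H × ℝ × ℝ => (z.1, z.2.2)))
      (measurableSet_singleton j))

theorem couplingLaw_real_fst (hQm : ∀ k ∈ Finset.Icc 1 K, Measurable (Q k))
    (hQ : ∀ᵐ x ∂ν, IsProbVector K fun k => Q k x) {i : ℕ} (hi : i ∈ Finset.Icc 1 K) :
    (couplingLaw ν).real {z | quantileMap K Q z.1 z.2.1 = i} = ∫ x, clip Q i x ∂ν := by
  rw [couplingLaw, measureReal_prod_eq_integral]
  · refine integral_congr_ae ?_
    filter_upwards [hQ] with x hx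
    have : (Prod.mk x ⁻¹' {z : H × ℝ × ℝ | quantileMap K Q z.1 z.2.1 = i}) =
        {u | quantileMap K Q x u = i} ×ˢ Set.univ := by ext; simp
    rw [clip_eq hx hi, ← uniform01_real_quantileMap hx hi, this, measureReal_prod_prod]
    simp
  · exact ((measurable_quantileMap hQm).comp
      (by fun_prop : Measurable fun z : H × ℝ × ℝ => (z.1, z.2.1))) (measurableSet_singleton i)

theorem couplingLaw_real_snd (hQm : ∀ k ∈ Finset.Icc 1 K, Measurable (Q k))
    (hQ : ∀ᵐ x ∂ν, IsProbVector K fun k => Q k x) {j : ℕ} (hj : j ∈ Finset.Icc 1 K) :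
    (couplingLaw ν).real {z | quantileMap K Q z.1 z.2.2 = j} = ∫ x, clip Q j x ∂ν := by
  rw [couplingLaw, measureReal_prod_eq_integral]
  · refine integral_congr_ae ?_
    filter_upwards [hQ] with x hx
    have : (Prod.mk x ⁻¹' {z : H × ℝ × ℝ | quantileMap K Q z.1 z.2.2 = j}) =
        Set.univ ×ˢ {u | quantileMap K Q x u = j} := by ext; simp
    rw [clip_eq hx hj, ← uniform01_real_quantileMap hx hj, this, measureReal_prod_prod]
    simp
  · exact ((measurable_quantileMap hQm).comp
      (by fun_prop : Measurable fun z : H × ℝ × ℝ => (z.1, z.2.2))) (measurableSet_singleton j)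

end Coupling

/-! ### Conditions (a) and (b), and passage to Cramér's V -/

section Convergence

variable {Ω H : Type*} [MeasurableSpace Ω] {μ : Measure Ω} [IsProbabilityMeasure μ]
  [MetricSpace H] [TopologicalSpace.SeparableSpace H] [MeasurableSpace H] [BorelSpace H]
  {X : ℕ → Ω → H} {Y : ℕ → Ω → ℕ} {K : ℕ} {Q : ℕ → H → ℝ}

theorem tendsto_integral_clip_of_continuous (hS : IsIIDSample μ X Y) {l : ℕ}
    (hm : Measurable (Q l)) (hc : ∀ᵐ x ∂μ.map (X 0), ContinuousAt (Q l) x) :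
    Tendsto (fun n => ∫ ω, |clip Q l (X (nnIndex (fun m => X m ω) n 0) ω) - clip Q l (X 0 ω)| ∂μ)
      atTop (𝓝 0) := by
  have hmeas : ∀ n, Measurable fun ω =>
      |clip Q l (X (nnIndex (fun m => X m ω) n 0) ω) - clip Q l (X 0 ω)| := fun n =>
    continuous_abs.measurable.comp (((measurable_clip hm).comp (hS.measurable_left_nnIndex n 0)).sub
      ((measurable_clip hm).comp (hS.measurable_left 0)))
  rw [← integral_zero Ω ℝ (μ := μ)]
  refine tendsto_integral_of_dominated_convergence (fun _ => 1)
    (fun n => (hmeas n).aestronglyMeasurable) (integrable_const _)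
    (fun n => Eventually.of_forall fun ω => ?_) ?_
  · rw [Real.norm_eq_abs, abs_abs]
    exact abs_clip_sub_clip_le_one _ _ _ _
  · filter_upwards [hS.ae_tendsto_dist_nnIndex,
      ae_of_ae_map (hS.measurable_left 0).aemeasurable hc] with ω h1 h2
    have h3 : Tendsto (fun n => X (nnIndex (fun m => X m ω) n 0) ω) atTop (𝓝 (X 0 ω)) := by
      rw [tendsto_iff_dist_tendsto_zero]
      simpa only [dist_comm] using h1
    have h4 : ContinuousAt (clip Q l) (X 0 ω) :=
      continuousAt_const.max (continuousAt_const.min h2)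
    have h5 := ((h4.tendsto.comp h3).sub_const (clip Q l (X 0 ω))).abs
    simpa using h5

/-- The coupling inequality bounds the integral by the probability, under `μ` times the uniform law,
that the two quantile maps disagree. Fubini and dominated convergence in `u` send it to zero. -/
theorem tendsto_integral_clip_of_neighborConvergence (hS : IsIIDSample μ X Y)
    (hQm : ∀ k ∈ Finset.Icc 1 K, Measurable (Q k))
    (hQ : ∀ᵐ x ∂μ.map (X 0), IsProbVector K fun k => Q k x)
    (hc : NeighborConvergence μ X K Q) {l : ℕ} (hl : l ∈ Finset.Icc 1 K) :
    Tendsto (fun n => ∫ ω, |clip Q l (X (nnIndex (fun m => X m ω) n 0) ω) - clip Q l (X 0 ω)| ∂μ)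
      atTop (𝓝 0) := by
  have hX := hS.measurable_left
  let D : ℕ → Set (Ω × ℝ) := fun n =>
    {p | quantileMap K Q (X (nnIndex (fun m => X m p.1) n 0) p.1) p.2 ≠
      quantileMap K Q (X 0 p.1) p.2}
  have hD : ∀ n, MeasurableSet (D n) := fun n => by
    have hq := measurable_quantileMap hQm
    have h1 : Measurable fun p : Ω × ℝ => quantileMap K Q (X 0 p.1) p.2 :=
      hq.comp (((hX 0).comp measurable_fst).prodMk measurable_snd)
    have h2 : Measurable fun p : Ω × ℝ =>
        quantileMap K Q (X (nnIndex (fun m => X m p.1) n 0) p.1) p.2 :=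
      hq.comp (((hS.measurable_left_nnIndex n 0).comp measurable_fst).prodMk measurable_snd)
    exact (measurableSet_eq_fun h2 h1).compl
  have hlim : Tendsto (fun n => (μ.prod uniform01) (D n)) atTop (𝓝 0) := by
    simp_rw [Measure.prod_apply_symm (hD _)]
    rw [← lintegral_zero (μ := uniform01)]
    refine tendsto_lintegral_of_dominated_convergence (fun _ => 1)
      (fun n => measurable_measure_prodMk_right (hD n))
      (fun n => Eventually.of_forall fun u => prob_le_one) (by simp) ?_
    filter_upwards [hc] with u hu
    rw [tendstoInMeasure_iff_dist] at hu
    -- Distinct natural numbers are at distance at least `1`, so convergence in probability controls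
    -- the event of disagreement itself.
    refine tendsto_of_tendsto_of_tendsto_of_le_of_le tendsto_const_nhds (hu 1 one_pos)
      (fun _ => zero_le) fun n => measure_mono fun ω hω => Nat.pairwise_one_le_dist hω
  have hlim' := (ENNReal.tendsto_toReal ENNReal.zero_ne_top).comp hlim
  simp only [ENNReal.toReal_zero] at hlim'
  have hgood : ∀ᵐ ω ∂μ, ∀ i, IsProbVector K fun k => Q k (X i ω) := ae_all_iff.2 fun i =>
    ae_of_ae_map (hX i).aemeasurable (by rw [(hS.identDistrib_fst i).map_eq]; exact hQ)
  refine squeeze_zero (fun n => integral_nonneg fun ω => abs_nonneg _) (fun n => ?_) hlim'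
  change _ ≤ (μ.prod uniform01).real (D n)
  rw [measureReal_prod_eq_integral (hD n)]
  refine integral_mono_of_nonneg (Eventually.of_forall fun ω => abs_nonneg _) ?_ ?_
  · exact integrable_of_abs_le (measurable_measure_prodMk_left (hD n)).ennreal_toReal (C := 1)
      fun ω => by
        exact (abs_of_nonneg ENNReal.toReal_nonneg).trans_le (measureReal_le_one (μ := uniform01))
  · filter_upwards [hgood] with ω hω
    rw [clip_eq (hω _) hl, clip_eq (hω _) hl]
    exact abs_sub_le_uniform01_real (hω _) (hω _) hl

omit [MetricSpace H] [TopologicalSpace.SeparableSpace H] [BorelSpace H] in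
theorem ae_forall_ne_of_integral_eq_zero (hS : IsIIDSample μ X Y) {k : ℕ} {g : H → ℝ}
    (hg : IsRegression μ (X 0) (Y 0) k g) (h0 : ∫ ω, g (X 0 ω) ∂μ = 0) :
    ∀ᵐ ω ∂μ, ∀ i, Y i ω ≠ k := by
  have hset : MeasurableSet (Y 0 ⁻¹' {k}) := hS.measurable_right 0 (measurableSet_singleton k)
  have h1 := hg.orthogonal (fun _ => 1) measurable_const ⟨1, by simp⟩
  simp only [one_mul] at h1
  rw [integral_sub, h0, sub_zero] at h1
  · have h2 : μ.real (Y 0 ⁻¹' {k}) = 0 := by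
      rw [← integral_indicator_one hset, ← h1]
      refine integral_congr_ae (Eventually.of_forall fun ω => ?_)
      by_cases h : Y 0 ω = k <;> simp [h]
    rw [measureReal_eq_zero_iff] at h2
    rw [ae_all_iff]
    intro i
    have h3 := ((hS.ident i).comp measurable_snd).measure_mem_eq (measurableSet_singleton k)
    exact measure_eq_zero_iff_ae_notMem.1 (h3.trans h2)
  · exact integrable_of_abs_le (measurable_ite_eq (hS.measurable_right 0) measurable_const) (C := 1)
      fun ω => by split_ifs <;> simp
  · exact integrable_of_abs_le (hg.measurable.comp (hS.measurable_left 0)) (C := 1) fun ω => by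
      rw [abs_of_nonneg (hg.nonneg _)]
      exact hg.le_one _

omit [TopologicalSpace.SeparableSpace H] [MeasurableSpace H] [BorelSpace H] in
theorem pHat_eq_zero {x : ℕ → H} {y : ℕ → ℕ} {k l : ℕ} (n : ℕ)
    (h : (∀ i, y i ≠ k) ∨ ∀ i, y i ≠ l) : pHat x y n k l = 0 := by
  rw [pHat, Finset.sum_eq_zero, mul_zero]
  intro i _
  rcases h with h | h <;> simp [h]

omit [TopologicalSpace.SeparableSpace H] [BorelSpace H] in
-- Marginals converge because the `g k` sum to `1`. Summands with nonzero limiting denominator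
-- converge by continuity; a zero denominator means that a label has probability zero and almost
-- surely never occurs.
theorem tendsto_psiHat (hS : IsIIDSample μ X Y) {g : ℕ → H → ℝ}
    (hg : ∀ k ∈ Finset.Icc 1 K, IsRegression μ (X 0) (Y 0) k (g k))
    (hg1 : ∀ᵐ ω ∂μ, ∑ k ∈ Finset.Icc 1 K, g k (X 0 ω) = 1)
    (hp : ∀ k ∈ Finset.Icc 1 K, ∀ l ∈ Finset.Icc 1 K,
      Tendsto (fun z : ℕ × Ω => pHat (fun m => X m z.2) (fun m => Y m z.2) z.1 k l) (inMeasure μ)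
        (𝓝 (∫ ω, g k (X 0 ω) * g l (X 0 ω) ∂μ))) :
    Tendsto (fun z : ℕ × Ω => psiHat K (fun m => X m z.2) (fun m => Y m z.2) z.1) (inMeasure μ)
      (𝓝 (cramerV K (fun k l => ∫ ω, g k (X 0 ω) * g l (X 0 ω) ∂μ)
        (fun k => ∫ ω, g k (X 0 ω) ∂μ) (fun l => ∫ ω, g l (X 0 ω) ∂μ))) := by
  have hint : ∀ k ∈ Finset.Icc 1 K, ∀ l ∈ Finset.Icc 1 K,
      Integrable (fun ω => g k (X 0 ω) * g l (X 0 ω)) μ := fun k hk l hl =>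
    integrable_of_abs_le (((hg k hk).measurable.comp (hS.measurable_left 0)).mul
      ((hg l hl).measurable.comp (hS.measurable_left 0))) (C := 1) fun ω => by
        rw [abs_mul, abs_of_nonneg ((hg k hk).nonneg _), abs_of_nonneg ((hg l hl).nonneg _)]
        exact mul_le_one₀ ((hg k hk).le_one _) ((hg l hl).nonneg _) ((hg l hl).le_one _)
  have hrow : ∀ k ∈ Finset.Icc 1 K, Tendsto (fun z : ℕ × Ω => ∑ l ∈ Finset.Icc 1 K,
      pHat (fun m => X m z.2) (fun m => Y m z.2) z.1 k l) (inMeasure μ)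
      (𝓝 (∫ ω, g k (X 0 ω) ∂μ)) := fun k hk => by
    have h := tendsto_finsetSum _ fun l hl => hp k hk l hl
    rw [← integral_finsetSum _ fun l hl => hint k hk l hl] at h
    convert h using 2
    refine integral_congr_ae ?_
    filter_upwards [hg1] with ω hω
    rw [← Finset.mul_sum, hω, mul_one]
  have hcol : ∀ l ∈ Finset.Icc 1 K, Tendsto (fun z : ℕ × Ω => ∑ k ∈ Finset.Icc 1 K,
      pHat (fun m => X m z.2) (fun m => Y m z.2) z.1 k l) (inMeasure μ)
      (𝓝 (∫ ω, g l (X 0 ω) ∂μ)) := fun l hl => by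
    have h := tendsto_finsetSum _ fun k hk => hp k hk l hl
    rw [← integral_finsetSum _ fun k hk => hint k hk l hl] at h
    convert h using 2
    refine integral_congr_ae ?_
    filter_upwards [hg1] with ω hω
    rw [← Finset.sum_mul, hω, one_mul]
  refine Tendsto.const_mul _ (tendsto_finsetSum _ fun k hk => tendsto_finsetSum _ fun l hl => ?_)
  by_cases h0 : (∫ ω, g k (X 0 ω) ∂μ) * ∫ ω, g l (X 0 ω) ∂μ = 0
  · simp only [h0, div_zero]
    -- The limiting summand is `0` since `x / 0 = 0`; the empirical one has denominator `0` almost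
    -- surely and equals `0` too.
    refine tendsto_const_nhds.congr' ?_
    have hdeg : ∀ᵐ ω ∂μ, ∀ n, (∑ l' ∈ Finset.Icc 1 K,
        pHat (fun m => X m ω) (fun m => Y m ω) n k l') * (∑ k' ∈ Finset.Icc 1 K,
        pHat (fun m => X m ω) (fun m => Y m ω) n k' l) = 0 := by
      rcases mul_eq_zero.1 h0 with h | h
      · filter_upwards [ae_forall_ne_of_integral_eq_zero hS (hg k hk) h] with ω hω n
        rw [Finset.sum_eq_zero fun l' _ => pHat_eq_zero n (Or.inl hω), zero_mul]
      · filter_upwards [ae_forall_ne_of_integral_eq_zero hS (hg l hl) h] with ω hω n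
        rw [Finset.sum_eq_zero (f := fun k' => pHat (fun m => X m ω) (fun m => Y m ω) n k' l)
          fun k' _ => pHat_eq_zero n (Or.inr hω), mul_zero]
    refine eventually_inMeasure_of_ae (Eventually.of_forall fun n => ?_)
    filter_upwards [hdeg] with ω hω
    simp only [hω n, div_zero]
  · exact (((hp k hk l hl).sub ((hrow k hk).mul (hcol l hl))).pow 2).div
      ((hrow k hk).mul (hcol l hl)) h0

end Convergence

end CategoricalDependence

open CategoricalDependence in
theorem mainTheorem3 {Ω H : Type*} [MeasurableSpace Ω] [MetricSpace H]
    [TopologicalSpace.SeparableSpace H] [MeasurableSpace H] [BorelSpace H]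
    (μ : Measure Ω) [IsProbabilityMeasure μ] (K : ℕ) (hK : 2 ≤ K)
    (X : ℕ → Ω → H) (Y : ℕ → Ω → ℕ)
    (hX : ∀ i, Measurable (X i)) (hY : ∀ i, Measurable (Y i))
    (hYK : ∀ i ω, Y i ω ∈ Finset.Icc 1 K)
    (hindep : iIndepFun (fun i ω => (X i ω, Y i ω)) μ)
    (hident : ∀ i, IdentDistrib (fun ω => (X i ω, Y i ω)) (fun ω => (X 0 ω, Y 0 ω)) μ μ)
    (hunique : CategoricalDependence.UniqueNearestNeighbors μ X)
    (Q : ℕ → H → ℝ) (hQ : CategoricalDependence.IsCondProb μ (X 0) (Y 0) K Q)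
    (hconv : CategoricalDependence.NeighborConvergence μ X K Q ∨
      CategoricalDependence.AECondProbContinuous (μ.map (X 0)) K Q) :
    TendstoInMeasure μ
      (fun n ω => CategoricalDependence.psiHat K (fun i => X i ω) (fun i => Y i ω) n) atTop
      (fun _ => CategoricalDependence.psi K Q (μ.map (X 0))) := by
  have hS : IsIIDSample μ X Y := ⟨hX, hY, hindep, hident⟩
  have hQm : ∀ k ∈ Finset.Icc 1 K, Measurable (Q k) := fun k hk => (hQ k hk).1
  have hprob := hQ.ae_isProbVector (hX 0) (hY 0) (hYK 0)
  have hreg : ∀ k ∈ Finset.Icc 1 K, IsRegression μ (X 0) (Y 0) k (clip Q k) := fun k hk =>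
    hQ.isRegression_clip (hX 0) (hY 0) (hYK 0) hk
  have hc : ∀ l ∈ Finset.Icc 1 K, Tendsto (fun n => ∫ ω,
      |clip Q l (X (nnIndex (fun m => X m ω) n 0) ω) - clip Q l (X 0 ω)| ∂μ) atTop (𝓝 0) :=
    fun l hl => hconv.elim
      (fun h => tendsto_integral_clip_of_neighborConvergence hS hQm hprob h hl)
      (fun h => tendsto_integral_clip_of_continuous hS (hQm l hl) (h l hl))
  have hsum : ∀ᵐ ω ∂μ, ∑ k ∈ Finset.Icc 1 K, clip Q k (X 0 ω) = 1 := by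
    filter_upwards [ae_of_ae_map (hX 0).aemeasurable hprob] with ω hω
    rw [← hω.2]
    exact Finset.sum_congr rfl fun k hk => clip_eq hω hk
  have hlim := tendsto_psiHat hS hreg hsum fun k hk l hl =>
    tendsto_pHat hS hunique (hreg k hk) (hreg l hl) (hc l hl)
  have := Measure.isProbabilityMeasure_map (μ := μ) (hX 0).aemeasurable
  have hmc : ∀ k ∈ Finset.Icc 1 K, Measurable (clip Q k) := fun k hk => measurable_clip (hQm k hk)
  have hpsi : psi K Q (μ.map (X 0)) =
      cramerV K (fun k l => ∫ ω, clip Q k (X 0 ω) * clip Q l (X 0 ω) ∂μ)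
        (fun k => ∫ ω, clip Q k (X 0 ω) ∂μ) (fun l => ∫ ω, clip Q l (X 0 ω) ∂μ) := by
    unfold psi cramerV
    refine congrArg _ (Finset.sum_congr rfl fun k hk => Finset.sum_congr rfl fun l hl => ?_)
    simp only [couplingLaw_real_pair hQm hprob hk hl, couplingLaw_real_fst hQm hprob hk,
      couplingLaw_real_snd hQm hprob hl]
    rw [integral_map (f := fun x => clip Q k x * clip Q l x) (hX 0).aemeasurable
        ((hmc k hk).mul (hmc l hl)).aestronglyMeasurable,
      integral_map (hX 0).aemeasurable (hmc k hk).aestronglyMeasurable,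
      integral_map (hX 0).aemeasurable (hmc l hl).aestronglyMeasurable]
  rw [hpsi]
  exact tendstoInMeasure_const_iff.2 hlim
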